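/- Let $\nu$ be a $\sigma$-finite Borel measure on $\mathbb R$ (for instance Lebesgue measure); all densities are with respect to $\nu$. Let $X_1,X_2,\dots$ be i.i.d. with law $P_0$, a Borel probability measure on $\mathbb R$ with density $p_0$. Let $\mathcal F$ be a collection of Borel probability measures $P$ on $\mathbb R$ with densities $p$, where $(P,x)\mapsto p(x)$ is jointly measurable and $\mathcal F$ carries the Borel $\sigma$-algebra of the weak topology. For each $n$ let $\Pi=\Pi_n$ be a prior probability distribution on $\mathcal F$, possibly depending on $n$, with posterior $$\Pi(A\mid X_1,\dots,X_n)=\frac{\int_A\prod_{i=1}^n \frac{p(X_i)}{p_0(X_i)}\,d\Pi(P)}{\int\prod_{i=1}^n \frac{p(X_i)}{p_0(X_i)}\,d\Pi(P)}.$$ For $p\ge1$ let $W_p(P,Q)=\inf_{\gamma}\big(\int|x-y|^p\,d\gamma(x,y)\big)^{1/p}\in[0,\infty]$, the infimum being over all couplings $\gamma$ of $P$ and $Q$. Let $B_0=(-1,1]$, $B_m=(-2^m,2^m]\setminus(-2^{m-1},2^{m-1}]$ for $m\ge1$, and $\pi_m(x)=x/2^m$. For $l\ge0$ let $\mathcal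 P_l$ be the partition of $(-1,1]$ into $2^l$ translates of $(-2^{-l},2^{-l}]$. Fix a real number $p\ge1$. Let $\epsilon_n\to0$ with $\epsilon_n\ge\sqrt{(\log n)/n}$ for all $n\ge1$, and assume the KL rate condition: for all large enough $n$, $$\Pi\Big(P\in\mathcal F:\ \int\log\frac{p_0}{p}\,dP_0\le\epsilon_n^2,\ \int\Big(\log\frac{p_0}{p}\Big)^2dP_0\le\epsilon_n^2\Big)\ge e^{-n\epsilon_n^2}.$$ Assume that there are constants $K,\delta>0$ such that $$P_0\big(\pi_m^{-1}(F)\cap B_m\big)\le\frac{K}{(l+1)^4}\,2^{-(2p+\delta)m}\qquad\text{for all } m\ge0,\ l\ge0,\ F\in\mathcal P_l,$$ and that $\Pi(\mathcal F_n^c\mid X_1,\dots,X_n)\to0$ in probability, where $$\mathcal F_n=\bigcap_{m\ge0}\ \bigcap_{0\le l\le L}\ \bigcap_{F\in\mathcal P_l}\Big\{P:\ P\big(\pi_m^{-1}(F)\cap B_m\big)\le\frac{K}{(l+1)^4}\,2^{-(2p+\delta)m}\Big\}$$ and $L=L_n$ is the largest integer less than or equal to $(\log_2\epsilon_n^{-1})/p$.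 Then there is a constant $K'>0$ such that $$\Pi\big(W_p^p(P,P_0)\ge K'\epsilon_n\mid X_1,\dots,X_n\big)\longrightarrow0\quad\text{in probability}.$$ -/

import Mathlib

open MeasureTheory ProbabilityTheory Filter Set
open scoped Topology NNReal ENNReal

noncomputable section

namespace WassersteinPosterior

/-- Couplings of two Borel probability measures on the real line. -/
def couplings (P Q : ProbabilityMeasure ℝ) : Set (ProbabilityMeasure (ℝ × ℝ)) :=
  {γ | (γ : Measure (ℝ × ℝ)).map Prod.fst = (P : Measure ℝ) ∧
    (γ : Measure (ℝ × ℝ)).map Prod.snd = (Q : Measure ℝ)}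

/-- The Wasserstein distance of order `p`; it may take the value `∞`. -/
def wasserstein (p : ℝ) (P Q : ProbabilityMeasure ℝ) : ℝ≥0∞ :=
  ⨅ γ ∈ couplings P Q,
    (∫⁻ z, ENNReal.ofReal (|z.1 - z.2| ^ p) ∂(γ : Measure (ℝ × ℝ))) ^ (1 / p)

/-- The sets `B_0 = (-1, 1]` and `B_m = (-2^m, 2^m] \ (-2^(m-1), 2^(m-1)]` for `m ≥ 1`. -/
def annulus : ℕ → Set ℝ
  | 0 => Ioc (-1) 1
  | m + 1 => Ioc (-2 ^ (m + 1)) (2 ^ (m + 1)) \ Ioc (-2 ^ m) (2 ^ m)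

/-- The partition of `(-1, 1]` into the `2^l` translates of `(-2^(-l), 2^(-l)]`. -/
def dyadicPartition (l : ℕ) : Set (Set ℝ) :=
  range fun k : Fin (2 ^ l) =>
    Ioc (-1 + 2 * (k : ℝ) / 2 ^ l) (-1 + 2 * ((k : ℝ) + 1) / 2 ^ l)

/-- The scaling map `π_m`. -/
def scaling (m : ℕ) (x : ℝ) : ℝ := x / 2 ^ m

/-- The tail bound at level `l`: for all `m ≥ 0` and all cells `F` of the level-`l` partition,
`P (π_m⁻¹ F ∩ B_m) ≤ K (l + 1)^(-4) 2^(-(2p + δ) m)`. -/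
def CellTailBound (p δ K : ℝ) (P : ProbabilityMeasure ℝ) (l : ℕ) : Prop :=
  ∀ m : ℕ, ∀ F ∈ dyadicPartition l,
    (P : Measure ℝ).real (scaling m ⁻¹' F ∩ annulus m) ≤
      K / ((l : ℝ) + 1) ^ 4 * (2 : ℝ) ^ (-(2 * p + δ) * (m : ℝ))

/-- The class of probability measures satisfying the tail bound at every level `l ≤ L`, where `L` is
the largest integer with `L ≤ (log₂ ε⁻¹) / p`. -/
def tailClass (p δ K ε : ℝ) : Set (ProbabilityMeasure ℝ) :=
  {P | ∀ l : ℕ, (l : ℤ) ≤ ⌊Real.logb 2 ε⁻¹ / p⌋ → CellTailBound p δ K P l}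

/-- The Kullback-Leibler type neighbourhood of `P₀`: the members of `𝓕` with
`∫ log (p₀ / p) dP₀ ≤ ε²` and `∫ (log (p₀ / p))² dP₀ ≤ ε²`. Positivity of `p` almost everywhere and
integrability are required explicitly, since `Real.log` and the Bochner integral take junk values
where these integrals are infinite. -/
def klNeighborhood {𝓕 : Set (ProbabilityMeasure ℝ)} (dens : 𝓕 → ℝ → ℝ≥0)
    (P₀ : ProbabilityMeasure ℝ) (dens₀ : ℝ → ℝ≥0) (ε : ℝ) : Set 𝓕 :=
  {P | (∀ᵐ x ∂(P₀ : Measure ℝ), 0 < dens P x) ∧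
    Integrable (fun x => Real.log (dens₀ x / dens P x)) (P₀ : Measure ℝ) ∧
    ∫ x, Real.log (dens₀ x / dens P x) ∂(P₀ : Measure ℝ) ≤ ε ^ 2 ∧
    Integrable (fun x => Real.log (dens₀ x / dens P x) ^ 2) (P₀ : Measure ℝ) ∧
    ∫ x, Real.log (dens₀ x / dens P x) ^ 2 ∂(P₀ : Measure ℝ) ≤ ε ^ 2}

/-- The posterior probability of `A` given the sample `x`, by Bayes' formula. -/
def posterior {𝓕 : Set (ProbabilityMeasure ℝ)} (prior : Measure 𝓕) (dens : 𝓕 → ℝ → ℝ≥0)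
    (dens₀ : ℝ → ℝ≥0) {n : ℕ} (x : Fin n → ℝ) (A : Set 𝓕) : ℝ :=
  ((∫⁻ P in A, ∏ i, ((dens P (x i) / dens₀ (x i) : ℝ≥0) : ℝ≥0∞) ∂prior) /
    ∫⁻ P, ∏ i, ((dens P (x i) / dens₀ (x i) : ℝ≥0) : ℝ≥0∞) ∂prior).toReal

end WassersteinPosterior

end

noncomputable section

namespace WassersteinPosterior

/-! ### Product measures and exponential moments -/

/-! The argument joins a deterministic transport estimate to a union bound over cells; no covering
of the model is needed. Write `q` for `cellBound`, the assumed bound on the mass of a cell.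

Transport. Cut the line into annuli and each annulus into dyadic cells. Match mass inside the finest
cells and pass each local surplus to the parent cell. Then `W_p^p` is at most the finest diameters
to the power `p`, weighted by mass, plus the discrepancies of the cells, weighted by the `p`-th
power of the diameter of the parent (`wasserstein_rpow_le_tsum`). Suppose that every discrepancy is
at most a constant times `ε √q`. Since `√q` is of order `(l+1)⁻² 2^(-(p+δ/2)m)`, the weights
`2^(pm)` of the annuli leave the summable `2^(-δm/2)`. The `2^l` cells of level `l` are paid for by
diameters `2^(-pl)`, as `p ≥ 1`, and `(l+1)⁻²` is summable. Stopping where `2^(-pL)` is comparable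
to `ε` leaves an error of order `ε`, also for the annuli beyond `L`
(`wasserstein_rpow_le_of_cells`).

Statistics. Let `y = nε²`. For one cell, the measures with mass at most `q` that deviate from `P₀`
by more than `12 ε √q` have small likelihood numerator, by a Chernoff bound of size `exp (-9y)`
(`numerator_deviationSet_le`). The KL condition keeps the evidence above `exp (-3y) / 2` with high
probability (`evidence_lt_le`). As `y ≥ log n`, there are at most `exp (2y)` cells, so the union
bound costs little. A measure of the tail class far from `P₀` deviates at some cell
(`subset_deviationSets`), hence such measures carry vanishing posterior mass. -/

lemma lintegral_pi_prod_eq_pow (Q : Measure ℝ) [IsProbabilityMeasure Q] (n : ℕ)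
    {f : ℝ → ℝ≥0∞} (hf : Measurable f) :
    ∫⁻ x, ∏ i, f (x i) ∂Measure.pi (fun _ : Fin n => Q) = (∫⁻ y, f y ∂Q) ^ n := by
  have hind : iIndepFun (fun (i : Fin n) (x : Fin n → ℝ) => f (x i))
      (Measure.pi fun _ : Fin n => Q) :=
    iIndepFun_pi (X := fun (_ : Fin n) => f) fun _ => hf.aemeasurable
  rw [lintegral_prod_eq_prod_lintegral_of_indepFun _ _ hind
    fun i => hf.comp (measurable_pi_apply i)]
  have h (i : Fin n) : ∫⁻ x, f (x i) ∂Measure.pi (fun _ : Fin n => Q) = ∫⁻ y, f y ∂Q :=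
    (measurePreserving_eval (fun _ : Fin n => Q) i).lintegral_comp hf
  simp [h]

/-- The integral equals `1 + Q(A)(e^θ - 1)`. Use `e^θ - 1 ≤ θ + θ²` for `|θ| ≤ 1`, then `1 + u ≤
e^u`. -/
lemma lintegral_exp_indicator_le (Q : Measure ℝ) [IsProbabilityMeasure Q] {A : Set ℝ}
    (hA : MeasurableSet A) {θ : ℝ} (hθ : |θ| ≤ 1) :
    ∫⁻ y, ENNReal.ofReal (Real.exp (θ * A.indicator 1 y)) ∂Q ≤
      ENNReal.ofReal (Real.exp (Q.real A * (θ + θ ^ 2))) := by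
  have h1 : (fun y => ENNReal.ofReal (Real.exp (θ * A.indicator 1 y))) =
      fun y => A.indicator (fun _ => ENNReal.ofReal (Real.exp θ)) y +
        Aᶜ.indicator (fun _ => (1 : ℝ≥0∞)) y := by
    ext y
    by_cases hy : y ∈ A <;> simp [hy]
  rw [h1, lintegral_add_left (measurable_const.indicator hA),
    lintegral_indicator_const hA, lintegral_indicator_const hA.compl, one_mul,
    ← ofReal_measureReal (s := A), ← ofReal_measureReal (s := Aᶜ), probReal_compl_eq_one_sub hA,
    ← ENNReal.ofReal_mul (Real.exp_nonneg _), ← ENNReal.ofReal_add (by positivity)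
      (by simp)]
  apply ENNReal.ofReal_le_ofReal
  have h2 := (abs_le.1 (Real.abs_exp_sub_one_sub_id_le hθ)).2
  have h3 := Real.add_one_le_exp (Q.real A * (θ + θ ^ 2))
  have h4 : 0 ≤ Q.real A := measureReal_nonneg
  nlinarith

lemma lintegral_exp_count_le (Q : Measure ℝ) [IsProbabilityMeasure Q] (n : ℕ) {A : Set ℝ}
    (hA : MeasurableSet A) {θ : ℝ} (hθ : |θ| ≤ 1) :
    (∫⁻ y, ENNReal.ofReal (Real.exp (θ * A.indicator 1 y)) ∂Q) ^ n ≤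
      ENNReal.ofReal (Real.exp (n * (Q.real A * (θ + θ ^ 2)))) := by
  rw [Real.exp_nat_mul, ENNReal.ofReal_pow (Real.exp_nonneg _)]
  gcongr
  exact lintegral_exp_indicator_le Q hA hθ

lemma prod_exp_indicator (n : ℕ) (A : Set ℝ) (θ : ℝ) (x : Fin n → ℝ) :
    ∏ i, ENNReal.ofReal (Real.exp (θ * A.indicator 1 (x i))) =
      ENNReal.ofReal (Real.exp (θ * ∑ i, A.indicator 1 (x i))) := by
  rw [Finset.mul_sum, Real.exp_sum, ENNReal.ofReal_prod_of_nonneg fun _ _ => Real.exp_nonneg _]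

lemma measurable_exp_indicator {A : Set ℝ} (hA : MeasurableSet A) (θ : ℝ) :
    Measurable fun y => ENNReal.ofReal (Real.exp (θ * A.indicator 1 y)) := by
  have : Measurable (A.indicator (1 : ℝ → ℝ)) := measurable_one.indicator hA
  fun_prop

/-- Chernoff bound for the number of points of an i.i.d. sample in a set of measure at most `q`. -/
lemma count_deviation_le (Q : Measure ℝ) [IsProbabilityMeasure Q] (n : ℕ) {A : Set ℝ}
    (hA : MeasurableSet A) {q t σ : ℝ} (ht : 0 < t) (htq : t ≤ q) (hq : Q.real A ≤ q)
    (hσ : |σ| = 1) :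
    Measure.pi (fun _ : Fin n => Q)
        {x | n * t / 2 ≤ σ * (∑ i, A.indicator 1 (x i) - n * Q.real A)} ≤
      ENNReal.ofReal (Real.exp (-(n * t ^ 2 / (16 * q)))) := by
  have hq0 : 0 < q := ht.trans_le htq
  -- This value minimizes the exponent per observation `q l² - l t / 2`, with minimum `-t² / (16
  -- q)`; `t ≤ q` keeps `l ≤ 1`.
  set l := t / (4 * q) with hl
  have hl0 : 0 < l := by positivity
  have hl1 : l ≤ 1 := by rw [hl, div_le_one (by positivity)]; linarith
  have hσ2 : σ ^ 2 = 1 := by rw [← sq_abs, hσ, one_pow]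
  have hθ : |σ * l| ≤ 1 := by rw [abs_mul, hσ, one_mul, abs_of_pos hl0]; exact hl1
  set c := Real.exp (-(σ * l * (n * Q.real A)) - l * (n * t / 2)) with hc
  have hm := measurable_exp_indicator hA (σ * l)
  have hmeas : Measurable fun x : Fin n → ℝ =>
      (∏ i, ENNReal.ofReal (Real.exp (σ * l * A.indicator 1 (x i)))) * ENNReal.ofReal c := by
    refine Measurable.mul_const (Finset.measurable_prod _ fun i _ => ?_) _
    exact hm.comp (measurable_pi_apply i)
  calc _ ≤ Measure.pi (fun _ : Fin n => Q) {x | 1 ≤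
        (∏ i, ENNReal.ofReal (Real.exp (σ * l * A.indicator 1 (x i)))) * ENNReal.ofReal c} := by
        apply measure_mono
        intro x hx
        simp only [mem_ofPred_eq] at hx ⊢
        rw [prod_exp_indicator, hc, ← ENNReal.ofReal_mul (Real.exp_nonneg _), ← Real.exp_add,
          ENNReal.one_le_ofReal]
        apply Real.one_le_exp
        nlinarith [mul_le_mul_of_nonneg_left hx hl0.le]
    _ ≤ ∫⁻ x, (∏ i, ENNReal.ofReal (Real.exp (σ * l * A.indicator 1 (x i)))) *
          ENNReal.ofReal c ∂Measure.pi (fun _ : Fin n => Q) := by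
        simpa using mul_meas_ge_le_lintegral (μ := Measure.pi (fun _ : Fin n => Q)) hmeas 1
    _ ≤ ENNReal.ofReal (Real.exp (n * (Q.real A * (σ * l + (σ * l) ^ 2)))) *
          ENNReal.ofReal c := by
        rw [lintegral_mul_const' _ _ ENNReal.ofReal_ne_top, lintegral_pi_prod_eq_pow Q n hm]
        gcongr
        exact lintegral_exp_count_le Q n hA hθ
    _ ≤ _ := by
        rw [hc, ← ENNReal.ofReal_mul (Real.exp_nonneg _), ← Real.exp_add]
        apply ENNReal.ofReal_le_ofReal
        apply Real.exp_le_exp.2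
        have h1 : (n : ℝ) * t ^ 2 / (16 * q) = n * (l * t / 2 - q * l ^ 2) := by
          rw [hl]; field_simp; ring
        have h2 : (n : ℝ) * (Q.real A * l ^ 2) ≤ n * (q * l ^ 2) := by gcongr
        rw [h1, mul_pow, hσ2]
        linarith

/-! ### Likelihood ratios -/

/-- The likelihood ratio of the sample `x`. -/
def likelihoodRatio {𝓕 : Set (ProbabilityMeasure ℝ)} (dens : 𝓕 → ℝ → ℝ≥0) (dens₀ : ℝ → ℝ≥0)
    {n : ℕ} (x : Fin n → ℝ) (P : 𝓕) : ℝ≥0∞ :=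
  ∏ i, ((dens P (x i) / dens₀ (x i) : ℝ≥0) : ℝ≥0∞)

variable {𝓕 : Set (ProbabilityMeasure ℝ)} {dens : 𝓕 → ℝ → ℝ≥0} {dens₀ : ℝ → ℝ≥0}

lemma measurable_likelihoodRatio (hdens₀m : Measurable dens₀)
    (hdensm : Measurable (Function.uncurry dens)) (n : ℕ) :
    Measurable fun z : (Fin n → ℝ) × 𝓕 => likelihoodRatio dens dens₀ z.1 z.2 := by
  unfold likelihoodRatio
  refine Finset.measurable_prod _ fun i _ => ?_
  have h1 : Measurable fun z : (Fin n → ℝ) × 𝓕 => dens z.2 (z.1 i) :=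
    hdensm.comp (measurable_snd.prodMk ((measurable_pi_apply i).comp measurable_fst))
  have h2 : Measurable fun z : (Fin n → ℝ) × 𝓕 => dens₀ (z.1 i) :=
    hdens₀m.comp ((measurable_pi_apply i).comp measurable_fst)
  exact (h1.div h2).coe_nnreal_ennreal

lemma measurable_dens (hdensm : Measurable (Function.uncurry dens)) (P : 𝓕) :
    Measurable (dens P) :=
  hdensm.comp (measurable_const.prodMk measurable_id)

/-- Change of measure. Only an inequality holds: where `d₀` vanishes the ratio is `0` by convention,
and the mass that `P` has there is lost. -/
lemma lintegral_ratio_mul_le {ν P₀ P : Measure ℝ} {d₀ d : ℝ → ℝ≥0} (hd₀ : Measurable d₀)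
    (hd : Measurable d) (hP₀ : P₀ = ν.withDensity fun x => (d₀ x : ℝ≥0∞))
    (hP : P = ν.withDensity fun x => (d x : ℝ≥0∞)) {f : ℝ → ℝ≥0∞} (hf : Measurable f) :
    ∫⁻ y, ((d y / d₀ y : ℝ≥0) : ℝ≥0∞) * f y ∂P₀ ≤ ∫⁻ y, f y ∂P := by
  have hr : Measurable fun y => ((d y / d₀ y : ℝ≥0) : ℝ≥0∞) * f y :=
    (hd.div hd₀).coe_nnreal_ennreal.mul hf
  rw [hP₀, hP, lintegral_withDensity_eq_lintegral_mul _ hd₀.coe_nnreal_ennreal hr,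
    lintegral_withDensity_eq_lintegral_mul _ hd.coe_nnreal_ennreal hf]
  apply lintegral_mono
  intro y
  simp only [Pi.mul_apply, ← mul_assoc]
  gcongr
  norm_cast
  rcases eq_or_ne (d₀ y) 0 with h | h
  · simp [h]
  · rw [mul_div_cancel₀ _ h]

lemma measurable_measureReal {A : Set ℝ} (hA : MeasurableSet A) :
    Measurable fun P : 𝓕 => ((P : ProbabilityMeasure ℝ) : Measure ℝ).real A := by
  have h1 : Measurable fun P : 𝓕 => ((P : ProbabilityMeasure ℝ) : Measure ℝ) :=
    measurable_subtype_coe.comp measurable_subtype_coe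
  exact ((Measure.measurable_coe hA).comp h1).ennreal_toReal

/-- With high probability the prior gives little weighted mass to measures whose value at a set of
measure at most `q` deviates from that of the true law by more than `t` in a given direction. -/
lemma numerator_one_sided_le {P₀ : ProbabilityMeasure ℝ} {ν : Measure ℝ}
    (hdens₀m : Measurable dens₀)
    (hdens₀ : (P₀ : Measure ℝ) = ν.withDensity fun x => (dens₀ x : ℝ≥0∞))
    (hdensm : Measurable (Function.uncurry dens))
    (hdens : ∀ P : 𝓕,
      ((P : ProbabilityMeasure ℝ) : Measure ℝ) = ν.withDensity fun x => (dens P x : ℝ≥0∞))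
    (prior : Measure 𝓕) [IsProbabilityMeasure prior] (n : ℕ) {A : Set ℝ}
    (hA : MeasurableSet A) {q t σ : ℝ} (ht : 0 < t) (htq : t ≤ q)
    (hq : (P₀ : Measure ℝ).real A ≤ q) (hσ : |σ| = 1) {s : ℝ≥0∞} (hs : s ≠ 0) (hs' : s ≠ ∞) :
    Measure.pi (fun _ : Fin n => (P₀ : Measure ℝ))
        {x | s ≤ ∫⁻ P in {P : 𝓕 | ((P : ProbabilityMeasure ℝ) : Measure ℝ).real A ≤ q ∧
            t < σ * (((P : ProbabilityMeasure ℝ) : Measure ℝ).real A - (P₀ : Measure ℝ).real A)},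
          likelihoodRatio dens dens₀ x P ∂prior} ≤
      ENNReal.ofReal (Real.exp (-(n * t ^ 2 / (16 * q)))) * (1 + s⁻¹) := by
  set U := {P : 𝓕 | ((P : ProbabilityMeasure ℝ) : Measure ℝ).real A ≤ q ∧
    t < σ * (((P : ProbabilityMeasure ℝ) : Measure ℝ).real A - (P₀ : Measure ℝ).real A)} with hU
  have hUm : MeasurableSet U :=
    (measurableSet_le (measurable_measureReal hA) measurable_const).inter
      (measurableSet_lt measurable_const
        (((measurable_measureReal hA).sub_const _).const_mul _))
  have hq0 : 0 < q := ht.trans_le htq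
  set l := t / (4 * q) with hl
  have hl0 : 0 < l := by positivity
  have hl1 : l ≤ 1 := by rw [hl, div_le_one (by positivity)]; linarith
  have hσ2 : σ ^ 2 = 1 := by rw [← sq_abs, hσ, one_pow]
  have hθ : |-(σ * l)| ≤ 1 := by rw [abs_neg, abs_mul, hσ, one_mul, abs_of_pos hl0]; exact hl1
  -- Tilting replaces a test. Let `N` be the number of observations in `A`. The total weight is `exp
  -- (l (σ (n P(A) - N) - n t / 2))`. On `U` it is at least `1` unless `N` deviates from `n P₀(A)`
  -- by `n t / 2` in direction `σ`, while its mean under `Pⁿ` is at most `exp (n (q l² - l t / 2)) =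
  -- e`. Fubini and Markov's inequality then bound the numerator, and the exceptional counts cost
  -- another `e`.
  set w : ℝ → ℝ≥0∞ := fun y => ENNReal.ofReal (Real.exp (-(σ * l) * A.indicator 1 y)) with hw
  have hwm : Measurable w := measurable_exp_indicator hA _
  set c : 𝓕 → ℝ := fun P => Real.exp (σ * l * (n * ((P : ProbabilityMeasure ℝ) : Measure ℝ).real A)
    - l * (n * t / 2)) with hc
  have hcm : Measurable c := by
    have := measurable_measureReal (𝓕 := 𝓕) hA
    fun_prop
  set g : (Fin n → ℝ) → 𝓕 → ℝ≥0∞ := fun x P =>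
    likelihoodRatio dens dens₀ x P * (∏ i, w (x i)) * ENNReal.ofReal (c P) with hg
  have hgm : Measurable (Function.uncurry g) := by
    refine ((measurable_likelihoodRatio hdens₀m hdensm n).mul ?_).mul
      (hcm.comp measurable_snd).ennreal_ofReal
    exact Finset.measurable_prod _ fun i _ =>
      hwm.comp ((measurable_pi_apply i).comp measurable_fst)
  set M := Measure.pi (fun _ : Fin n => (P₀ : Measure ℝ)) with hM
  set e := ENNReal.ofReal (Real.exp (-(n * t ^ 2 / (16 * q)))) with he
  have hE (P : 𝓕) (hP : P ∈ U) : ∫⁻ x, g x P ∂M ≤ e := by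
    have h1 : ∀ x : Fin n → ℝ, likelihoodRatio dens dens₀ x P * ∏ i, w (x i) =
        ∏ i, (((dens P (x i) / dens₀ (x i) : ℝ≥0) : ℝ≥0∞) * w (x i)) := fun x => by
      rw [likelihoodRatio, Finset.prod_mul_distrib]
    simp only [hg, h1]
    rw [lintegral_mul_const' _ _ ENNReal.ofReal_ne_top, hM,
      lintegral_pi_prod_eq_pow _ n (f := fun y => ((dens P y / dens₀ y : ℝ≥0) : ℝ≥0∞) * w y)
        (((measurable_dens hdensm P).div hdens₀m).coe_nnreal_ennreal.mul hwm)]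
    calc _ ≤ (∫⁻ y, w y ∂((P : ProbabilityMeasure ℝ) : Measure ℝ)) ^ n *
          ENNReal.ofReal (c P) := by
          exact mul_le_mul' (pow_le_pow_left' (lintegral_ratio_mul_le hdens₀m
            (measurable_dens hdensm P) hdens₀ (hdens P) hwm) n) le_rfl
      _ ≤ ENNReal.ofReal (Real.exp (n * (((P : ProbabilityMeasure ℝ) : Measure ℝ).real A *
            (-(σ * l) + (-(σ * l)) ^ 2)))) * ENNReal.ofReal (c P) := by
          gcongr
          exact lintegral_exp_count_le _ n hA hθ
      _ ≤ e := by
          rw [hc, ← ENNReal.ofReal_mul (Real.exp_nonneg _), ← Real.exp_add]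
          apply ENNReal.ofReal_le_ofReal
          apply Real.exp_le_exp.2
          have h1 : (n : ℝ) * t ^ 2 / (16 * q) = n * (l * t / 2 - q * l ^ 2) := by
            rw [hl]; field_simp; ring
          have h2 : (n : ℝ) * (((P : ProbabilityMeasure ℝ) : Measure ℝ).real A * l ^ 2) ≤
            n * (q * l ^ 2) := by gcongr; exact hP.1
          rw [h1, neg_sq, mul_pow, hσ2]
          linarith
  have hG : ∫⁻ x, ∫⁻ P in U, g x P ∂prior ∂M ≤ e := by
    rw [lintegral_lintegral_swap hgm.aemeasurable]
    calc _ ≤ ∫⁻ _ in U, e ∂prior := setLIntegral_mono' hUm hE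
      _ ≤ e := by
        rw [setLIntegral_const]
        exact mul_le_of_le_one_right' prob_le_one
  have hsub : {x | s ≤ ∫⁻ P in U, likelihoodRatio dens dens₀ x P ∂prior} ⊆
      {x | n * t / 2 ≤ σ * (∑ i, A.indicator 1 (x i) - n * (P₀ : Measure ℝ).real A)} ∪
        {x | s ≤ ∫⁻ P in U, g x P ∂prior} := by
    intro x hx
    by_cases hx' : n * t / 2 ≤ σ * (∑ i, A.indicator 1 (x i) - n * (P₀ : Measure ℝ).real A)
    · exact Or.inl hx'
    · refine Or.inr (le_trans (mem_ofPred_eq ▸ hx) (setLIntegral_mono' hUm fun P hP => ?_))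
      simp only [hg, mul_assoc]
      refine le_mul_of_one_le_right' ?_
      rw [hw, prod_exp_indicator, hc, ← ENNReal.ofReal_mul (Real.exp_nonneg _), ← Real.exp_add,
          ENNReal.one_le_ofReal]
      apply Real.one_le_exp
      push Not at hx'
      have h3 : (n : ℝ) * t ≤ n * (σ * (((P : ProbabilityMeasure ℝ) : Measure ℝ).real A -
        (P₀ : Measure ℝ).real A)) := by gcongr; exact hP.2.le
      have h4 : 0 ≤ -(n * t / 2) + n * (σ * (((P : ProbabilityMeasure ℝ) : Measure ℝ).real A -
        (P₀ : Measure ℝ).real A)) - σ * (∑ i, A.indicator 1 (x i) -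
          n * (P₀ : Measure ℝ).real A) := by linarith
      linarith [mul_nonneg hl0.le h4]
  calc _ ≤ _ := (measure_mono hsub).trans (measure_union_le _ _)
    _ ≤ e + e / s := by
      gcongr
      · exact count_deviation_le _ n hA ht htq hq hσ
      · refine (meas_ge_le_lintegral_div ?_ hs hs').trans (by gcongr)
        exact hgm.lintegral_prod_right'.aemeasurable
    _ = e * (1 + s⁻¹) := by rw [mul_add, mul_one, ENNReal.div_eq_inv_mul, mul_comm s⁻¹]

/-! ### The evidence lower bound -/

/-- Chebyshev's inequality: the second moment bounds the variance, so the sum has mean and variance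
at most `n e`, and reaching `2 n e` is a deviation of at least `n e`. -/
lemma sum_deviation_le (Q : Measure ℝ) [IsProbabilityMeasure Q] {n : ℕ} (hn : 0 < n)
    {g : ℝ → ℝ} (hg : Measurable g) {e : ℝ} (he : 0 < e)
    (h1 : ∫ y, g y ∂Q ≤ e) (h2i : Integrable (fun y => g y ^ 2) Q) (h2 : ∫ y, g y ^ 2 ∂Q ≤ e) :
    Measure.pi (fun _ : Fin n => Q) {x | 2 * (n * e) ≤ ∑ i, g (x i)} ≤
      ENNReal.ofReal (1 / (n * e)) := by
  set M := Measure.pi (fun _ : Fin n => Q) with hM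
  have hL : MemLp g 2 Q := (memLp_two_iff_integrable_sq hg.aestronglyMeasurable).2 h2i
  have hmp (i : Fin n) : MeasurePreserving (fun x : Fin n → ℝ => x i) M Q :=
    measurePreserving_eval (fun _ : Fin n => Q) i
  have hLi (i : Fin n) : MemLp (fun x : Fin n → ℝ => g (x i)) 2 M :=
    hL.comp_measurePreserving (hmp i)
  have hind : iIndepFun (fun (i : Fin n) (x : Fin n → ℝ) => g (x i)) M :=
    iIndepFun_pi (X := fun (_ : Fin n) => g) fun _ => hg.aemeasurable
  have hn' : (0 : ℝ) < n := by exact_mod_cast hn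
  set S : (Fin n → ℝ) → ℝ := ∑ i, fun x => g (x i) with hS
  have hSx (x) : S x = ∑ i, g (x i) := by simp [hS]
  have hSL : MemLp S 2 M := memLp_finsetSum' _ fun i _ => hLi i
  have hmean : ∫ x, S x ∂M ≤ n * e := by
    simp_rw [hSx]
    rw [integral_finsetSum _ fun i _ => (hLi i).integrable (by norm_num)]
    have (i : Fin n) : ∫ x, g (x i) ∂M = ∫ y, g y ∂Q := by
      rw [← (hmp i).map_eq, integral_map (hmp i).measurable.aemeasurable
        hg.aestronglyMeasurable]
    simp only [this, Finset.sum_const, Finset.card_univ, Fintype.card_fin, nsmul_eq_mul]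
    gcongr
  have hvar : variance S M ≤ n * e := by
    rw [hS, IndepFun.variance_sum (fun i _ => hLi i) fun i _ j _ hij => hind.indepFun hij]
    have (i : Fin n) : variance (fun x : Fin n → ℝ => g (x i)) M ≤ e := by
      refine (variance_le_expectation_sq (hLi i).1).trans (le_trans (le_of_eq ?_) h2)
      simp only [Pi.pow_apply]
      rw [← (hmp i).map_eq, integral_map (hmp i).measurable.aemeasurable
        (hg.pow_const 2).aestronglyMeasurable]
    calc _ ≤ ∑ _i : Fin n, e := Finset.sum_le_sum fun i _ => this i
      _ = n * e := by simp
  have hpos : 0 < n * e := by positivity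
  calc _ ≤ M {x | n * e ≤ |S x - ∫ x, S x ∂M|} := by
        apply measure_mono
        intro x hx
        simp only [mem_ofPred_eq, ← hSx] at hx ⊢
        exact le_trans (by linarith) (le_abs_self _)
    _ ≤ ENNReal.ofReal (variance S M / (n * e) ^ 2) := meas_ge_le_variance_div_sq hSL hpos
    _ ≤ _ := by
        apply ENNReal.ofReal_le_ofReal
        rw [div_le_div_iff₀ (by positivity) hpos]
        nlinarith

lemma measurableSet_klNeighborhood (P₀ : ProbabilityMeasure ℝ) (hdens₀m : Measurable dens₀)
    (hdensm : Measurable (Function.uncurry dens)) (ε : ℝ) :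
    MeasurableSet (klNeighborhood dens P₀ dens₀ ε) := by
  have hlog : Measurable (Function.uncurry fun (P : 𝓕) x =>
      Real.log (dens₀ x / dens P x)) := by
    have h1 : Measurable fun z : 𝓕 × ℝ => (dens z.1 z.2 : ℝ) := hdensm.coe_nnreal_real
    have h2 : Measurable fun z : 𝓕 × ℝ => (dens₀ z.2 : ℝ) :=
      (hdens₀m.comp measurable_snd).coe_nnreal_real
    exact (h2.div h1).log
  have hlog2 : Measurable (Function.uncurry fun (P : 𝓕) x =>
      Real.log (dens₀ x / dens P x) ^ 2) := hlog.pow_const 2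
  refine MeasurableSet.inter ?_ (.inter ?_ (.inter ?_ (.inter ?_ ?_)))
  · have h : MeasurableSet {z : 𝓕 × ℝ | ¬ 0 < dens z.1 z.2} :=
      (measurableSet_lt measurable_const hdensm).compl
    exact measurable_measure_prodMk_left (ν := (P₀ : Measure ℝ)) h (measurableSet_singleton 0)
  · exact measurableSet_integrable hlog.stronglyMeasurable
  · exact measurableSet_le hlog.stronglyMeasurable.integral_prod_right.measurable
      measurable_const
  · exact measurableSet_integrable hlog2.stronglyMeasurable
  · exact measurableSet_le hlog2.stronglyMeasurable.integral_prod_right.measurable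
      measurable_const

/-- Both densities are positive at almost every sample, so the likelihood ratio is the exponential
of minus a sum of log ratios, to which `sum_deviation_le` applies with `e = ε²`. -/
lemma likelihoodRatio_lt_le {P₀ : ProbabilityMeasure ℝ} {ν : Measure ℝ}
    (hdens₀m : Measurable dens₀)
    (hdens₀ : (P₀ : Measure ℝ) = ν.withDensity fun x => (dens₀ x : ℝ≥0∞))
    (hdensm : Measurable (Function.uncurry dens)) {n : ℕ} (hn : 0 < n) {ε : ℝ} (hε : 0 < ε)
    {P : 𝓕} (hP : P ∈ klNeighborhood dens P₀ dens₀ ε) :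
    Measure.pi (fun _ : Fin n => (P₀ : Measure ℝ))
        {x | likelihoodRatio dens dens₀ x P < ENNReal.ofReal (Real.exp (-(2 * (n * ε ^ 2))))} ≤
      ENNReal.ofReal (1 / (n * ε ^ 2)) := by
  obtain ⟨hpos, -, h1, h2i, h2⟩ := hP
  have hpos₀ : ∀ᵐ y ∂(P₀ : Measure ℝ), 0 < dens₀ y := by
    rw [hdens₀, ae_withDensity_iff hdens₀m.coe_nnreal_ennreal]
    exact Eventually.of_forall fun y hy => pos_iff_ne_zero.2 (by simpa using hy)
  have hall : ∀ᵐ x ∂Measure.pi (fun _ : Fin n => (P₀ : Measure ℝ)),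
      ∀ i, 0 < dens P (x i) ∧ 0 < dens₀ (x i) := by
    rw [ae_all_iff]
    exact fun i => (measurePreserving_eval (fun _ : Fin n => (P₀ : Measure ℝ))
      i).quasiMeasurePreserving.ae (hpos.and hpos₀)
  have hm : Measurable fun y => Real.log (dens₀ y / dens P y) :=
    (hdens₀m.coe_nnreal_real.div (measurable_dens hdensm P).coe_nnreal_real).log
  refine (measure_mono_ae ?_).trans
    (sum_deviation_le (P₀ : Measure ℝ) hn hm (by positivity : 0 < ε ^ 2) h1 h2i h2)
  filter_upwards [hall] with x hx hlt
  change likelihoodRatio dens dens₀ x P < _ at hlt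
  change 2 * (n * ε ^ 2) ≤ ∑ i, Real.log (dens₀ (x i) / dens P (x i))
  have hL : likelihoodRatio dens dens₀ x P =
      ENNReal.ofReal (Real.exp (-∑ i, Real.log (dens₀ (x i) / dens P (x i)))) := by
    rw [← Finset.sum_neg_distrib, Real.exp_sum,
      ENNReal.ofReal_prod_of_nonneg fun _ _ => Real.exp_nonneg _, likelihoodRatio]
    refine Finset.prod_congr rfl fun i _ => ?_
    have h3 : (0 : ℝ) < dens P (x i) := (hx i).1
    have h4 : (0 : ℝ) < dens₀ (x i) := (hx i).2
    rw [← Real.log_inv, inv_div, Real.exp_log (by positivity), ← NNReal.coe_div,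
      ENNReal.ofReal_coe_nnreal]
  rw [hL, ENNReal.ofReal_lt_ofReal_iff (Real.exp_pos _), Real.exp_lt_exp] at hlt
  linarith

/-- The evidence is bounded below with high probability. -/
lemma evidence_lt_le {P₀ : ProbabilityMeasure ℝ} {ν : Measure ℝ}
    (hdens₀m : Measurable dens₀)
    (hdens₀ : (P₀ : Measure ℝ) = ν.withDensity fun x => (dens₀ x : ℝ≥0∞))
    (hdensm : Measurable (Function.uncurry dens)) (prior : Measure 𝓕) [IsProbabilityMeasure prior]
    {n : ℕ} (hn : 0 < n) {ε : ℝ} (hε : 0 < ε)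
    (hKL : Real.exp (-(n * ε ^ 2)) ≤ prior.real (klNeighborhood dens P₀ dens₀ ε)) :
    Measure.pi (fun _ : Fin n => (P₀ : Measure ℝ))
        {x | ∫⁻ P, likelihoodRatio dens dens₀ x P ∂prior <
          ENNReal.ofReal (Real.exp (-(3 * (n * ε ^ 2))) / 2)} ≤
      ENNReal.ofReal (2 / (n * ε ^ 2)) := by
  set V := klNeighborhood dens P₀ dens₀ ε with hV
  have hVm : MeasurableSet V := measurableSet_klNeighborhood P₀ hdens₀m hdensm ε
  set M := Measure.pi (fun _ : Fin n => (P₀ : Measure ℝ)) with hM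
  set b := ENNReal.ofReal (Real.exp (-(2 * (n * ε ^ 2)))) with hb
  set y : ℝ := n * ε ^ 2 with hy
  have hy0 : 0 < y := by positivity
  have hVpos : 0 < prior.real V := (Real.exp_pos _).trans_le hKL
  have hLm := measurable_likelihoodRatio hdens₀m hdensm n
  set D : Set ((Fin n → ℝ) × 𝓕) := {z | likelihoodRatio dens dens₀ z.1 z.2 < b} with hD
  have hDm : MeasurableSet D := measurableSet_lt hLm measurable_const
  have hVr : prior V = ENNReal.ofReal (prior.real V) := (ofReal_measureReal).symm
  -- For each `P` in `V` a small likelihood ratio has probability at most `1 / y`; by Fubini the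
  -- same bound holds for the expected fraction of `V` with a small ratio.
  have hfub : ∫⁻ x, (prior.restrict V) (Prod.mk x ⁻¹' D) ∂M ≤
      ENNReal.ofReal (1 / y) * prior V := by
    rw [← Measure.prod_apply hDm, Measure.prod_apply_symm hDm]
    calc _ ≤ ∫⁻ _ in V, ENNReal.ofReal (1 / y) ∂prior :=
          setLIntegral_mono' hVm fun P hP => likelihoodRatio_lt_le hdens₀m hdens₀ hdensm hn hε hP
      _ = _ := setLIntegral_const _ _
  have hhalf : ENNReal.ofReal (prior.real V / 2) ≠ 0 := by simpa using hVpos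
  have hsub : {x | ∫⁻ P, likelihoodRatio dens dens₀ x P ∂prior <
      ENNReal.ofReal (Real.exp (-(3 * y)) / 2)} ⊆
      {x | ENNReal.ofReal (prior.real V / 2) ≤ (prior.restrict V) (Prod.mk x ⁻¹' D)} := by
    intro x hx
    by_contra hx'
    simp only [mem_ofPred_eq, not_le] at hx hx'
    refine absurd hx (not_lt.2 ?_)
    have hBm : MeasurableSet (Prod.mk x ⁻¹' D) := measurable_prodMk_left hDm
    -- Off the Markov event at least half of `V` has likelihood ratio at least `exp (-2y)`, and `V`
    -- has prior mass at least `exp (-y)`: hence `exp (-3y) / 2`.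
    have h1 : ENNReal.ofReal (prior.real V / 2) ≤ (prior.restrict V) (Prod.mk x ⁻¹' D)ᶜ := by
      have h2 := measure_add_measure_compl (μ := prior.restrict V) hBm
      rw [Measure.restrict_apply_univ, hVr, ← add_halves (prior.real V),
        ENNReal.ofReal_add (by positivity) (by positivity)] at h2
      by_contra h3
      exact (ENNReal.add_lt_add hx' (not_le.1 h3)).ne h2
    calc ENNReal.ofReal (Real.exp (-(3 * y)) / 2)
        ≤ b * ENNReal.ofReal (prior.real V / 2) := by
          rw [hb, ← ENNReal.ofReal_mul (Real.exp_nonneg _)]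
          apply ENNReal.ofReal_le_ofReal
          rw [show -(3 * y) = -(2 * y) + -y by ring, Real.exp_add]
          nlinarith [Real.exp_pos (-(2 * y))]
      _ ≤ b * (prior.restrict V) (Prod.mk x ⁻¹' D)ᶜ := by gcongr
      _ = ∫⁻ _ in (Prod.mk x ⁻¹' D)ᶜ, b ∂(prior.restrict V) := (setLIntegral_const _ _).symm
      _ ≤ ∫⁻ P in (Prod.mk x ⁻¹' D)ᶜ, likelihoodRatio dens dens₀ x P ∂(prior.restrict V) :=
          setLIntegral_mono' hBm.compl fun P hP => not_lt.1 hP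
      _ ≤ ∫⁻ P, likelihoodRatio dens dens₀ x P ∂prior :=
          (setLIntegral_le_lintegral _ _).trans (setLIntegral_le_lintegral _ _)
  calc _ ≤ _ := measure_mono hsub
    _ ≤ (∫⁻ x, (prior.restrict V) (Prod.mk x ⁻¹' D) ∂M) / ENNReal.ofReal (prior.real V / 2) :=
        meas_ge_le_lintegral_div (measurable_measure_prodMk_left hDm).aemeasurable hhalf
          ENNReal.ofReal_ne_top
    _ ≤ (ENNReal.ofReal (1 / y) * prior V) / ENNReal.ofReal (prior.real V / 2) := by gcongr
    _ = ENNReal.ofReal (2 / y) := by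
        rw [hVr, ← ENNReal.ofReal_mul (by positivity), ← ENNReal.ofReal_div_of_pos (by positivity)]
        congr 1
        field_simp

/-! ### Partial transport plans -/

/-- There is a plan of cost at most `C` which transports as much mass as possible from `μ` to `ν`:
the mass left over in one of the two measures vanishes. -/
def PartialTransport (cost : ℝ × ℝ → ℝ≥0∞) (μ ν : Measure ℝ) (C : ℝ≥0∞) : Prop :=
  ∃ (γ : Measure (ℝ × ℝ)) (α β : Measure ℝ), γ.map Prod.fst + α = μ ∧ γ.map Prod.snd + β = ν ∧
    (α = 0 ∨ β = 0) ∧ ∫⁻ z, cost z ∂γ ≤ C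

variable {cost : ℝ × ℝ → ℝ≥0∞}

lemma PartialTransport.mono {μ ν : Measure ℝ} {C C' : ℝ≥0∞} (h : PartialTransport cost μ ν C)
    (hC : C ≤ C') : PartialTransport cost μ ν C' := by
  obtain ⟨γ, α, β, h1, h2, h3, h4⟩ := h
  exact ⟨γ, α, β, h1, h2, h3, h4.trans hC⟩

/-- The plan is the product measure divided by the larger of the two masses; the lighter measure is
then used up entirely. The separable bound `f x + f y` lets the cost integrate against each
marginal. -/
lemma PartialTransport.of_cost_le (hcost : Measurable cost) {μ ν : Measure ℝ} [IsFiniteMeasure μ]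
    [IsFiniteMeasure ν] {f : ℝ → ℝ≥0∞} (hf : Measurable f)
    (h : ∀ᵐ x ∂μ, ∀ᵐ y ∂ν, cost (x, y) ≤ f x + f y) :
    PartialTransport cost μ ν (∫⁻ x, f x ∂μ + ∫⁻ y, f y ∂ν) := by
  set m := max (μ univ) (ν univ) with hm
  have hmtop : m ≠ ∞ := by simp [hm]
  rcases eq_or_ne m 0 with h0 | h0
  · obtain ⟨ha, hb⟩ : μ univ = 0 ∧ ν univ = 0 := by simpa [hm] using h0
    refine ⟨0, 0, 0, ?_, ?_, Or.inl rfl, by simp⟩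
    · simp [Measure.measure_univ_eq_zero.1 ha]
    · simp [Measure.measure_univ_eq_zero.1 hb]
  · have hle (a : ℝ≥0∞) (ha : a ≤ m) : m⁻¹ * a ≤ 1 := by
      rw [← ENNReal.div_eq_inv_mul]
      exact ENNReal.div_le_of_le_mul (by simpa using ha)
    have hcancel (a : ℝ≥0∞) (ha : a ≤ m) (ρ : Measure ℝ) :
        (m⁻¹ * a) • ρ + (1 - m⁻¹ * a) • ρ = ρ := by
      rw [← add_smul, add_tsub_cancel_of_le (hle a ha), one_smul]
    refine ⟨m⁻¹ • μ.prod ν, (1 - m⁻¹ * ν univ) • μ, (1 - m⁻¹ * μ univ) • ν, ?_, ?_, ?_, ?_⟩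
    · rw [Measure.map_smul, Measure.map_fst_prod, smul_smul]
      exact hcancel _ (le_max_right _ _) μ
    · rw [Measure.map_smul, Measure.map_snd_prod, smul_smul]
      exact hcancel _ (le_max_left _ _) ν
    · rcases max_choice (μ univ) (ν univ) with h' | h'
      · right
        rw [← h', ← hm, ENNReal.inv_mul_cancel h0 hmtop]
        simp
      · left
        rw [← h', ← hm, ENNReal.inv_mul_cancel h0 hmtop]
        simp
    · rw [lintegral_smul_measure, lintegral_prod _ hcost.aemeasurable]
      calc _ ≤ m⁻¹ * ∫⁻ x, ∫⁻ y, (f x + f y) ∂ν ∂μ := by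
            rw [smul_eq_mul]
            exact mul_le_mul' le_rfl
              (lintegral_mono_ae (h.mono fun x hx => lintegral_mono_ae hx))
        _ = (m⁻¹ * ν univ) * ∫⁻ x, f x ∂μ + (m⁻¹ * μ univ) * ∫⁻ y, f y ∂ν := by
            simp_rw [lintegral_add_left measurable_const, lintegral_const]
            rw [lintegral_add_right _ measurable_const, lintegral_const,
              lintegral_mul_const _ hf]
            ring
        _ ≤ 1 * ∫⁻ x, f x ∂μ + 1 * ∫⁻ y, f y ∂ν := by
            gcongr
            · exact hle _ (le_max_right _ _)
            · exact hle _ (le_max_left _ _)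
        _ = _ := by simp

/-- Both marginals of the plan have the same mass, so with one remainder zero the other is exactly
the excess mass. Truncated subtraction covers both cases. -/
lemma remainder_univ {γ : Measure (ℝ × ℝ)} {α β μ ν : Measure ℝ} [IsFiniteMeasure μ]
    [IsFiniteMeasure ν] (h1 : γ.map Prod.fst + α = μ) (h2 : γ.map Prod.snd + β = ν)
    (h3 : α = 0 ∨ β = 0) : α univ = μ univ - ν univ ∧ β univ = ν univ - μ univ := by
  have e1 : γ univ + α univ = μ univ := by
    rw [← h1, Measure.add_apply, Measure.map_apply measurable_fst MeasurableSet.univ, preimage_univ]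
  have e2 : γ univ + β univ = ν univ := by
    rw [← h2, Measure.add_apply, Measure.map_apply measurable_snd MeasurableSet.univ, preimage_univ]
  have hγ : γ univ ≠ ∞ := ne_top_of_le_ne_top (measure_ne_top μ univ) (e1 ▸ le_self_add)
  rcases h3 with rfl | rfl
  · simp only [Measure.coe_zero, Pi.zero_apply, add_zero] at e1 ⊢
    rw [← e1, ← e2, ENNReal.add_sub_cancel_left hγ]
    simp [tsub_eq_zero_of_le (le_self_add (a := γ univ))]
  · simp only [Measure.coe_zero, Pi.zero_apply, add_zero] at e2 ⊢
    rw [← e1, ← e2, ENNReal.add_sub_cancel_left hγ]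
    simp [tsub_eq_zero_of_le (le_self_add (a := γ univ))]

/-- The discrepancy `|μ A - ν A|`. -/
def discrepancy (μ ν : Measure ℝ) (A : Set ℝ) : ℝ≥0∞ := (μ A - ν A) + (ν A - μ A)

/-- Plans on the pieces of a countable decomposition combine to a plan for the sums; the mass left
over in the pieces is bounded by the discrepancies. -/
lemma PartialTransport.sum {ι : Type*} [Countable ι] (hcost : Measurable cost)
    {μ ν : ι → Measure ℝ} [IsFiniteMeasure (Measure.sum μ)] [IsFiniteMeasure (Measure.sum ν)]
    {C B : ι → ℝ≥0∞} (hC : ∀ i, PartialTransport cost (μ i) (ν i) (C i))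
    {f : ℝ → ℝ≥0∞} (hf : Measurable f)
    (h : ∀ᵐ x ∂Measure.sum μ, ∀ᵐ y ∂Measure.sum ν, cost (x, y) ≤ f x + f y)
    (hμ : ∀ i, ∀ᵐ x ∂μ i, f x ≤ B i) (hν : ∀ i, ∀ᵐ y ∂ν i, f y ≤ B i) :
    PartialTransport cost (Measure.sum μ) (Measure.sum ν)
      (∑' i, (C i + B i * discrepancy (μ i) (ν i) univ)) := by
  choose γ α β h1 h2 h3 h4 using hC
  have hμle (i) : μ i ≤ Measure.sum μ := Measure.le_sum μ i
  have hνle (i) : ν i ≤ Measure.sum ν := Measure.le_sum ν i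
  have hfμ (i) : IsFiniteMeasure (μ i) := isFiniteMeasure_of_le _ (hμle i)
  have hfν (i) : IsFiniteMeasure (ν i) := isFiniteMeasure_of_le _ (hνle i)
  have hα (i) : α i ≤ μ i := h1 i ▸ Measure.le_add_left le_rfl
  have hβ (i) : β i ≤ ν i := h2 i ▸ Measure.le_add_left le_rfl
  have e1 : (Measure.sum γ).map Prod.fst + Measure.sum α = Measure.sum μ := by
    rw [Measure.map_sum measurable_fst.aemeasurable, Measure.sum_add_sum]
    simp_rw [h1]
  have e2 : (Measure.sum γ).map Prod.snd + Measure.sum β = Measure.sum ν := by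
    rw [Measure.map_sum measurable_snd.aemeasurable, Measure.sum_add_sum]
    simp_rw [h2]
  have hαs : Measure.sum α ≤ Measure.sum μ := e1 ▸ Measure.le_add_left le_rfl
  have hβs : Measure.sum β ≤ Measure.sum ν := e2 ▸ Measure.le_add_left le_rfl
  have : IsFiniteMeasure (Measure.sum α) := isFiniteMeasure_of_le _ hαs
  have : IsFiniteMeasure (Measure.sum β) := isFiniteMeasure_of_le _ hβs
  -- The pooled surpluses are transported by a second plan; in piece `i` they have total mass equal
  -- to the discrepancy there, which gives the term with `B i`.
  obtain ⟨γ', α', β', f1, f2, f3, f4⟩ := PartialTransport.of_cost_le hcost hf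
    (μ := Measure.sum α) (ν := Measure.sum β)
    (ae_mono hαs (h.mono fun x hx => ae_mono hβs hx))
  refine ⟨Measure.sum γ + γ', α', β', ?_, ?_, f3, ?_⟩
  · rw [Measure.map_add _ _ measurable_fst, add_assoc, f1, e1]
  · rw [Measure.map_add _ _ measurable_snd, add_assoc, f2, e2]
  · rw [lintegral_add_measure, lintegral_sum_measure, ENNReal.tsum_add]
    refine add_le_add (ENNReal.tsum_le_tsum h4) (f4.trans ?_)
    rw [lintegral_sum_measure, lintegral_sum_measure, ← ENNReal.tsum_add]
    refine ENNReal.tsum_le_tsum fun i => ?_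
    obtain ⟨g1, g2⟩ := remainder_univ (h1 i) (h2 i) (h3 i)
    rw [discrepancy, mul_add, ← g1, ← g2, ← lintegral_const, ← lintegral_const]
    exact add_le_add (lintegral_mono_ae (ae_mono (hα i) (hμ i)))
      (lintegral_mono_ae (ae_mono (hβ i) (hν i)))

/-- Multi-level transport inside a cell of a binary tree of sets. -/
lemma PartialTransport.of_tree (hcost : Measurable cost) {μ ν : Measure ℝ} [IsFiniteMeasure μ]
    [IsFiniteMeasure ν] {S : ℕ → ℕ → Set ℝ} (hS : ∀ l k, MeasurableSet (S l k))
    (hunion : ∀ l k, S l k = S (l + 1) (2 * k) ∪ S (l + 1) (2 * k + 1))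
    (hdisj : ∀ l k, Disjoint (S (l + 1) (2 * k)) (S (l + 1) (2 * k + 1)))
    {D T : ℕ → ℝ≥0∞} (hD : ∀ l k, ∀ x ∈ S l k, ∀ y ∈ S l k, cost (x, y) ≤ D l) {L : ℕ}
    (hT : ∀ l ≤ L, ∀ k < 2 ^ l, discrepancy μ ν (S l k) ≤ T l) (r : ℕ) :
    ∀ l k, l + r ≤ L → k < 2 ^ l →
      PartialTransport cost (μ.restrict (S l k)) (ν.restrict (S l k))
        (D (l + r) * (μ (S l k) + ν (S l k)) +
          ∑ j ∈ Finset.range r, D (l + j) * 2 ^ (j + 1) * T (l + j + 1)) := by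
  have hae (l k : ℕ) : ∀ᵐ x ∂μ.restrict (S l k), ∀ᵐ y ∂ν.restrict (S l k),
      cost (x, y) ≤ D l + D l := by
    filter_upwards [ae_restrict_mem (hS l k)] with x hx
    filter_upwards [ae_restrict_mem (hS l k)] with y hy
    exact (hD l k x hx y hy).trans le_self_add
  -- Induction on the number of further subdivisions. With none left, the product plan inside the
  -- cell costs at most its diameter term times the two masses. Otherwise the plans of the two
  -- children are combined, and their surpluses travel inside the parent at cost `D l`.
  induction r with
  | zero =>
    intro l k _ _
    refine (PartialTransport.of_cost_le hcost (f := fun _ => D l) measurable_const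
      (hae l k)).mono (le_of_eq ?_)
    simp [mul_add]
  | succ r ih =>
    intro l k hl hk
    have hk2 (b : Bool) : 2 * k + b.toNat < 2 ^ (l + 1) := by
      rw [pow_succ]; cases b <;> simp <;> omega
    have hsum (ρ : Measure ℝ) : ρ.restrict (S l k) =
        Measure.sum fun b : Bool => ρ.restrict (S (l + 1) (2 * k + b.toNat)) := by
      rw [Measure.sum_bool, hunion l k, Measure.restrict_union (hdisj l k) (hS _ _), add_comm]
      simp
    have hmeas (ρ : Measure ℝ) :
        ρ (S l k) = ρ (S (l + 1) (2 * k + 1)) + ρ (S (l + 1) (2 * k)) := by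
      rw [hunion l k, measure_union (hdisj l k) (hS _ _), add_comm]
    have : IsFiniteMeasure
        (Measure.sum fun b : Bool => μ.restrict (S (l + 1) (2 * k + b.toNat))) := by
      rw [← hsum]; infer_instance
    have : IsFiniteMeasure
        (Measure.sum fun b : Bool => ν.restrict (S (l + 1) (2 * k + b.toNat))) := by
      rw [← hsum]; infer_instance
    have key := PartialTransport.sum hcost (B := fun _ => D l)
      (fun b : Bool => ih (l + 1) (2 * k + b.toNat) (by omega) (hk2 b)) (f := fun _ => D l)
      measurable_const (by rw [← hsum, ← hsum]; exact hae l k)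
      (fun _ => by simp) (fun _ => by simp)
    rw [← hsum, ← hsum] at key
    refine key.mono ?_
    have hT' (b : Bool) : discrepancy (μ.restrict (S (l + 1) (2 * k + b.toNat)))
        (ν.restrict (S (l + 1) (2 * k + b.toNat))) univ ≤ T (l + 1) := by
      simpa [discrepancy] using hT (l + 1) (by omega) _ (hk2 b)
    calc _ ≤ ∑' b : Bool, (D (l + 1 + r) * (μ (S (l + 1) (2 * k + b.toNat)) +
            ν (S (l + 1) (2 * k + b.toNat))) +
          ∑ j ∈ Finset.range r, D (l + 1 + j) * 2 ^ (j + 1) * T (l + 1 + j + 1) +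
          D l * T (l + 1)) := by
          refine ENNReal.tsum_le_tsum fun b => ?_
          gcongr
          exact hT' b
      _ = _ := by
          rw [tsum_bool, Finset.sum_range_succ', hmeas μ, hmeas ν,
            show l + 1 + r = l + (r + 1) by omega]
          -- Passing from the children to the parent doubles the number of cells at each level,
          -- whence the factor `2 ^ (j + 1)`.
          have : ∑ j ∈ Finset.range r, D (l + (j + 1)) * 2 ^ (j + 1 + 1) * T (l + (j + 1) + 1) =
              2 * ∑ j ∈ Finset.range r, D (l + 1 + j) * 2 ^ (j + 1) * T (l + 1 + j + 1) := by
            rw [Finset.mul_sum]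
            refine Finset.sum_congr rfl fun j _ => ?_
            rw [show l + (j + 1) = l + 1 + j by omega]
            ring
          rw [this]
          simp only [Bool.toNat_false, Bool.toNat_true, add_zero]
          ring

/-! ### Geometry of the cells -/

lemma measurableSet_annulus (m : ℕ) : MeasurableSet (annulus m) := by
  cases m with
  | zero => exact measurableSet_Ioc
  | succ m => exact measurableSet_Ioc.diff measurableSet_Ioc

lemma annulus_eq_disjointed :
    annulus = disjointed fun m : ℕ => Ioc (-2 ^ m : ℝ) (2 ^ m) := by
  have hmono : Monotone fun m : ℕ => Ioc (-2 ^ m : ℝ) (2 ^ m) := by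
    intro a b hab
    have : (2 : ℝ) ^ a ≤ 2 ^ b := pow_le_pow_right₀ (by norm_num) hab
    exact Ioc_subset_Ioc (by linarith) this
  ext1 m
  cases m with
  | zero => simp [annulus]
  | succ m => rw [hmono.disjointed_add_one]; rfl

lemma iUnion_annulus : ⋃ m, annulus m = univ := by
  rw [annulus_eq_disjointed, iUnion_disjointed, eq_univ_iff_forall]
  intro x
  obtain ⟨m, hm⟩ := pow_unbounded_of_one_lt |x| (by norm_num : (1 : ℝ) < 2)
  exact mem_iUnion.2 ⟨m, (abs_lt.1 hm).1, (abs_lt.1 hm).2.le⟩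

lemma pairwise_disjoint_annulus : Pairwise (Function.onFun Disjoint annulus) := by
  rw [annulus_eq_disjointed]
  exact disjoint_disjointed _

lemma annulus_subset (m : ℕ) : annulus m ⊆ Ioc (-2 ^ m) (2 ^ m) := by
  rw [annulus_eq_disjointed]
  exact disjointed_subset _ m

/-- The cell of index `k` at level `l` of the annulus of index `m`. -/
def cell (m l k : ℕ) : Set ℝ :=
  scaling m ⁻¹' Ioc (-1 + 2 * (k : ℝ) / 2 ^ l) (-1 + 2 * ((k : ℝ) + 1) / 2 ^ l) ∩ annulus m

lemma measurableSet_cell (m l k : ℕ) : MeasurableSet (cell m l k) := by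
  have : Measurable (scaling m) := by unfold scaling; fun_prop
  exact (this measurableSet_Ioc).inter (measurableSet_annulus m)

lemma cell_zero (m : ℕ) : cell m 0 0 = annulus m := by
  refine inter_eq_right.2 fun x hx => ?_
  obtain ⟨h1, h2⟩ := annulus_subset m hx
  have h3 : (0 : ℝ) < 2 ^ m := by positivity
  simp only [scaling, mem_preimage, mem_Ioc, lt_div_iff₀ h3, div_le_iff₀ h3]
  norm_num
  exact ⟨h1, h2⟩

lemma cell_eq_union (m l k : ℕ) :
    cell m l k = cell m (l + 1) (2 * k) ∪ cell m (l + 1) (2 * k + 1) := by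
  have e0 : (0 : ℝ) < 2 ^ l := by positivity
  have e1 : -1 + 2 * ((2 * k : ℕ) : ℝ) / 2 ^ (l + 1) = -1 + 2 * (k : ℝ) / 2 ^ l := by
    push_cast; rw [pow_succ]; field_simp
  have e2 : -1 + 2 * (((2 * k + 1 : ℕ) : ℝ) + 1) / 2 ^ (l + 1) =
      -1 + 2 * ((k : ℝ) + 1) / 2 ^ l := by
    push_cast; rw [pow_succ]; field_simp; ring
  have e3 : -1 + 2 * (((2 * k : ℕ) : ℝ) + 1) / 2 ^ (l + 1) =
      -1 + 2 * ((2 * k + 1 : ℕ) : ℝ) / 2 ^ (l + 1) := by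
    push_cast; rfl
  rw [cell, cell, cell, ← union_inter_distrib_right, ← preimage_union, e1, e2, e3,
    Ioc_union_Ioc_eq_Ioc]
  · rw [← e1]; push_cast; gcongr; linarith
  · rw [← e2]; push_cast; gcongr; linarith

lemma disjoint_cell (m l k : ℕ) :
    Disjoint (cell m (l + 1) (2 * k)) (cell m (l + 1) (2 * k + 1)) := by
  refine Disjoint.mono inter_subset_left inter_subset_left (Disjoint.preimage _ ?_)
  refine Ioc_disjoint_Ioc_of_le ?_
  push_cast
  rfl

lemma abs_sub_le_of_mem_cell {m l k : ℕ} {x y : ℝ} (hx : x ∈ cell m l k) (hy : y ∈ cell m l k) :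
    |x - y| ≤ 2 ^ m * (2 / 2 ^ l) := by
  obtain ⟨hx1, hx2⟩ := hx.1
  obtain ⟨hy1, hy2⟩ := hy.1
  have h : |scaling m x - scaling m y| ≤ 2 / 2 ^ l := by
    have : -1 + 2 * ((k : ℝ) + 1) / 2 ^ l = -1 + 2 * (k : ℝ) / 2 ^ l + 2 / 2 ^ l := by ring
    rw [abs_sub_le_iff]
    constructor <;> linarith
  have h3 : (0 : ℝ) < 2 ^ m := by positivity
  rwa [scaling, scaling, ← sub_div, abs_div, abs_of_pos h3, div_le_iff₀' h3] at h

/-- The transport cost of order `p`. -/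
def powerCost (p : ℝ) (z : ℝ × ℝ) : ℝ≥0∞ := ENNReal.ofReal (|z.1 - z.2| ^ p)

lemma measurable_powerCost (p : ℝ) : Measurable (powerCost p) := by
  unfold powerCost
  fun_prop

/-- Separable bound for transport between different annuli, where no common diameter is available.
-/
lemma powerCost_le {p : ℝ} (hp : 1 ≤ p) (x y : ℝ) :
    powerCost p (x, y) ≤ ENNReal.ofReal (2 ^ p * |x| ^ p) + ENNReal.ofReal (2 ^ p * |y| ^ p) := by
  rw [← ENNReal.ofReal_add (by positivity) (by positivity)]
  apply ENNReal.ofReal_le_ofReal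
  have h1 : |x - y| ≤ 2 * max |x| |y| := by
    have := abs_sub x y
    linarith [le_max_left |x| |y|, le_max_right |x| |y|]
  calc |x - y| ^ p ≤ (2 * max |x| |y|) ^ p := by gcongr
    _ = 2 ^ p * (max |x| |y|) ^ p := Real.mul_rpow (by norm_num) (by positivity)
    _ ≤ _ := by
      rcases max_choice |x| |y| with h | h <;> rw [h]
      · linarith [show 0 ≤ 2 ^ p * |y| ^ p by positivity]
      · linarith [show 0 ≤ 2 ^ p * |x| ^ p by positivity]

/-- Two probability measures have equal mass, so nothing is left over and the partial plan is a
coupling. -/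
lemma wasserstein_rpow_le {p : ℝ} (hp : 1 ≤ p) {P Q : ProbabilityMeasure ℝ} {C : ℝ≥0∞}
    (h : PartialTransport (powerCost p) (P : Measure ℝ) (Q : Measure ℝ) C) :
    wasserstein p P Q ^ p ≤ C := by
  obtain ⟨γ, α, β, h1, h2, h3, h4⟩ := h
  obtain ⟨g1, g2⟩ := remainder_univ h1 h2 h3
  have hα : α = 0 := by simpa using g1
  have hβ : β = 0 := by simpa using g2
  rw [hα, add_zero] at h1
  rw [hβ, add_zero] at h2
  have hγ : IsProbabilityMeasure γ := ⟨by
    rw [← preimage_univ (f := Prod.fst), ← Measure.map_apply measurable_fst MeasurableSet.univ, h1]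
    exact measure_univ⟩
  have hle : wasserstein p P Q ≤ (∫⁻ z, powerCost p z ∂γ) ^ (1 / p) :=
    iInf₂_le (⟨γ, hγ⟩ : ProbabilityMeasure (ℝ × ℝ)) ⟨h1, h2⟩
  calc _ ≤ ((∫⁻ z, powerCost p z ∂γ) ^ (1 / p)) ^ p := by gcongr
    _ = ∫⁻ z, powerCost p z ∂γ := by
      rw [← ENNReal.rpow_mul, one_div_mul_cancel (by linarith), ENNReal.rpow_one]
    _ ≤ C := h4

/-- The `p`-th power of the diameter of the cells of level `l` in the annulus of index `m`. -/
def cellCost (p : ℝ) (m l : ℕ) : ℝ≥0∞ := ENNReal.ofReal ((2 ^ m * (2 / 2 ^ l)) ^ p)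

lemma powerCost_le_cellCost {p : ℝ} (hp : 1 ≤ p) {m l k : ℕ} {x y : ℝ} (hx : x ∈ cell m l k)
    (hy : y ∈ cell m l k) : powerCost p (x, y) ≤ cellCost p m l := by
  apply ENNReal.ofReal_le_ofReal
  have := abs_sub_le_of_mem_cell hx hy
  gcongr

/-- Multi-level bound for the Wasserstein distance in terms of the discrepancies of the cells. -/
theorem wasserstein_rpow_le_tsum {p : ℝ} (hp : 1 ≤ p) (P Q : ProbabilityMeasure ℝ) (L : ℕ → ℕ)
    {T : ℕ → ℕ → ℝ≥0∞}
    (hT : ∀ m, ∀ l ≤ L m, ∀ k < 2 ^ l,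
      discrepancy (P : Measure ℝ) (Q : Measure ℝ) (cell m l k) ≤ T m l) :
    wasserstein p P Q ^ p ≤
      ∑' m, (cellCost p m (L m) * ((P : Measure ℝ) (annulus m) + (Q : Measure ℝ) (annulus m)) +
        ∑ j ∈ Finset.range (L m), cellCost p m j * 2 ^ (j + 1) * T m (j + 1) +
        cellCost p m 0 * T m 0) := by
  apply wasserstein_rpow_le hp
  have hsum (ρ : Measure ℝ) : Measure.sum (fun m => ρ.restrict (annulus m)) = ρ := by
    rw [← Measure.restrict_iUnion pairwise_disjoint_annulus measurableSet_annulus, iUnion_annulus,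
      Measure.restrict_univ]
  have hf : Measurable fun x : ℝ => ENNReal.ofReal (2 ^ p * |x| ^ p) := by fun_prop
  have : IsFiniteMeasure (Measure.sum fun m => (P : Measure ℝ).restrict (annulus m)) := by
    rw [hsum]; infer_instance
  have : IsFiniteMeasure (Measure.sum fun m => (Q : Measure ℝ).restrict (annulus m)) := by
    rw [hsum]; infer_instance
  have hle (m : ℕ) : ∀ x ∈ annulus m, ENNReal.ofReal (2 ^ p * |x| ^ p) ≤ cellCost p m 0 := by
    intro x hx
    obtain ⟨h1, h2⟩ := annulus_subset m hx
    apply ENNReal.ofReal_le_ofReal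
    rw [← Real.mul_rpow (by norm_num) (abs_nonneg _)]
    have : |x| ≤ 2 ^ m := abs_le.2 ⟨h1.le, h2⟩
    have : 2 * |x| ≤ 2 ^ m * (2 / 2 ^ 0) := by norm_num; linarith
    gcongr
  have htree (m : ℕ) := PartialTransport.of_tree (measurable_powerCost p) (μ := (P : Measure ℝ))
    (ν := (Q : Measure ℝ)) (S := cell m) (measurableSet_cell m) (cell_eq_union m)
    (disjoint_cell m) (D := cellCost p m)
    (fun l k x hx y hy => powerCost_le_cellCost hp hx hy) (hT m) (L m) 0 0 (by simp) (by simp)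
  simp only [cell_zero, zero_add] at htree
  have key := PartialTransport.sum (measurable_powerCost p) htree hf
    (ae_of_all _ fun x => ae_of_all _ fun y => powerCost_le hp x y)
    (fun m => (ae_restrict_mem (measurableSet_annulus m)).mono (hle m))
    (fun m => (ae_restrict_mem (measurableSet_annulus m)).mono (hle m))
  rw [hsum, hsum] at key
  refine key.mono (ENNReal.tsum_le_tsum fun m => ?_)
  gcongr
  have := hT m 0 (Nat.zero_le _) 0 (by simp)
  rw [cell_zero] at this
  simpa [discrepancy] using this

/-! ### The Wasserstein bound for measures with controlled tails -/

/-- The bound for the mass of the cells of level `l` in the annulus of index `m`. -/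
def cellBound (p δ K : ℝ) (m l : ℕ) : ℝ :=
  K / ((l : ℝ) + 1) ^ 4 * (2 : ℝ) ^ (-(2 * p + δ) * (m : ℝ))

lemma cellBound_pos {p δ K : ℝ} (hK : 0 < K) (m l : ℕ) : 0 < cellBound p δ K m l := by
  unfold cellBound; positivity

lemma sqrt_cellBound {p δ K : ℝ} (hK : 0 < K) (m l : ℕ) :
    √(cellBound p δ K m l) = √K / ((l : ℝ) + 1) ^ 2 * (2 : ℝ) ^ (-(p + δ / 2) * (m : ℝ)) := by
  rw [Real.sqrt_eq_iff_mul_self_eq_of_pos (by positivity), cellBound]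
  have h : (2 : ℝ) ^ (-(2 * p + δ) * (m : ℝ)) =
      (2 : ℝ) ^ (-(p + δ / 2) * (m : ℝ)) * (2 : ℝ) ^ (-(p + δ / 2) * (m : ℝ)) := by
    rw [← Real.rpow_add (by norm_num)]; congr 1; ring
  rw [h]
  field_simp
  exact Real.sq_sqrt hK.le

lemma CellTailBound.cell_le {p δ K : ℝ} {P : ProbabilityMeasure ℝ} {l : ℕ}
    (h : CellTailBound p δ K P l) (m : ℕ) {k : ℕ} (hk : k < 2 ^ l) :
    (P : Measure ℝ).real (cell m l k) ≤ cellBound p δ K m l :=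
  h m _ ⟨⟨k, hk⟩, rfl⟩

lemma CellTailBound.annulus_le {p δ K : ℝ} {P : ProbabilityMeasure ℝ}
    (h : CellTailBound p δ K P 0) (m : ℕ) :
    (P : Measure ℝ) (annulus m) ≤ ENNReal.ofReal (K * (2 : ℝ) ^ (-(2 * p + δ) * (m : ℝ))) := by
  have := h.cell_le m (k := 0) (by simp)
  rw [cell_zero] at this
  rw [← ofReal_measureReal]
  apply ENNReal.ofReal_le_ofReal
  simpa [cellBound] using this

lemma rpow_diam (p : ℝ) (m l : ℕ) :
    ((2 : ℝ) ^ m * (2 / 2 ^ l)) ^ p = (2 : ℝ) ^ (p * m + p - p * l) := by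
  have : (2 : ℝ) ^ m * (2 / 2 ^ l) = (2 : ℝ) ^ ((m : ℝ) + 1 - l) := by
    rw [Real.rpow_sub (by norm_num), Real.rpow_add (by norm_num), Real.rpow_natCast,
      Real.rpow_natCast, Real.rpow_one]
    ring
  rw [this, ← Real.rpow_mul (by norm_num)]
  congr 1; ring

lemma sum_range_inv_sq_le (n : ℕ) :
    ∑ j ∈ Finset.range n, 1 / ((j : ℝ) + 2) ^ 2 ≤ 1 - 1 / ((n : ℝ) + 1) := by
  induction n with
  | zero => simp
  | succ n ih =>
    rw [Finset.sum_range_succ]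
    have h : 1 / ((n : ℝ) + 2) ^ 2 ≤ 1 / ((n : ℝ) + 1) - 1 / (((n + 1 : ℕ) : ℝ) + 1) := by
      push_cast
      rw [div_sub_div _ _ (by positivity) (by positivity),
        div_le_div_iff₀ (by positivity) (by positivity)]
      nlinarith [Nat.cast_nonneg (α := ℝ) n]
    linarith

lemma discrepancy_eq_ofReal {P Q : Measure ℝ} [IsFiniteMeasure P] [IsFiniteMeasure Q]
    (A : Set ℝ) : discrepancy P Q A = ENNReal.ofReal |P.real A - Q.real A| := by
  rw [discrepancy, ← ofReal_measureReal (μ := P), ← ofReal_measureReal (μ := Q),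
    ← ENNReal.ofReal_sub _ measureReal_nonneg, ← ENNReal.ofReal_sub _ measureReal_nonneg]
  rcases le_total (P.real A) (Q.real A) with h | h
  · rw [ENNReal.ofReal_of_nonpos (by linarith), zero_add, abs_of_nonpos (by linarith), neg_sub]
  · rw [ENNReal.ofReal_of_nonpos (p := Q.real A - P.real A) (by linarith), add_zero,
      abs_of_nonneg (by linarith)]

/-- The constant in `wasserstein_rpow_le_of_cells`. -/
def wassersteinConst (p δ K M : ℝ) : ℝ :=
  (2 ^ p * 2 ^ p * (2 * K) + 3 * 2 ^ p * (M * √K) + 4 * 2 ^ p * K) / (1 - 2 ^ (-(δ / 2)))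

lemma wassersteinConst_pos {p δ K M : ℝ} (hδ : 0 < δ) (hK : 0 < K) (hM : 0 < M) :
    0 < wassersteinConst p δ K M := by
  have : (2 : ℝ) ^ (-(δ / 2)) < 1 := Real.rpow_lt_one_of_one_lt_of_neg (by norm_num) (by linarith)
  have : 0 < 1 - (2 : ℝ) ^ (-(δ / 2)) := by linarith
  unfold wassersteinConst
  positivity

/-- The mass at the finest level pays `2^(-pL)`, of order `ε`. At level `j + 1` the factor `2^(j+1)
2^(-pj)` is at most `2`, so the sum is controlled by the series of `(j+2)⁻²`. In every term the
powers of `2^m` combine to at most `2^(-δm/2)`. -/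
lemma near_term_le {p δ K M ε : ℝ} (hp : 1 ≤ p) (hδ : 0 < δ) (hK : 0 < K) (hM : 0 < M)
    (hε : 0 < ε) {L : ℕ} (hL : (2 : ℝ) ^ (-(p * L)) ≤ 2 ^ p * ε) (m : ℕ) :
    (2 : ℝ) ^ (p * m + p - p * L) * (2 * (K * (2 : ℝ) ^ (-(2 * p + δ) * (m : ℝ)))) +
      ∑ j ∈ Finset.range L, (2 : ℝ) ^ (p * m + p - p * j) * 2 ^ (j + 1) *
        (M * ε * √(cellBound p δ K m (j + 1))) +
      (2 : ℝ) ^ (p * m + p - p * (0 : ℕ)) * (M * ε * √(cellBound p δ K m 0)) ≤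
    (2 ^ p * 2 ^ p * (2 * K) + 3 * 2 ^ p * (M * √K)) * ε * (2 : ℝ) ^ (-(δ / 2) * (m : ℝ)) := by
  have h2 : (0 : ℝ) < 2 := by norm_num
  have hm : (0 : ℝ) ≤ m := Nat.cast_nonneg m
  set R := (2 : ℝ) ^ (-(δ / 2) * (m : ℝ)) with hR
  have t1 : (2 : ℝ) ^ (p * m + p - p * L) * (2 * (K * (2 : ℝ) ^ (-(2 * p + δ) * (m : ℝ)))) ≤
      2 ^ p * 2 ^ p * (2 * K) * ε * R := by
    calc _ = 2 * K * ((2 : ℝ) ^ (p * m + p - p * L) * (2 : ℝ) ^ (-(2 * p + δ) * (m : ℝ))) := by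
          ring
      _ ≤ 2 * K * (2 ^ p * (2 : ℝ) ^ (-(p * L)) * R) := by
          rw [hR, ← Real.rpow_add h2, ← Real.rpow_add h2, ← Real.rpow_add h2]
          refine mul_le_mul_of_nonneg_left
            (Real.rpow_le_rpow_of_exponent_le one_le_two ?_) (by positivity)
          nlinarith [mul_nonneg hδ.le hm, mul_nonneg (by linarith : 0 ≤ p) hm]
      _ ≤ 2 * K * (2 ^ p * (2 ^ p * ε) * R) := by gcongr
      _ = _ := by ring
  have t2 (j : ℕ) : (2 : ℝ) ^ (p * m + p - p * j) * 2 ^ (j + 1) *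
        (M * ε * √(cellBound p δ K m (j + 1))) ≤
      2 * 2 ^ p * (M * √K) * ε * R * (1 / ((j : ℝ) + 2) ^ 2) := by
    rw [sqrt_cellBound hK, ← Real.rpow_natCast 2 (j + 1)]
    push_cast
    calc _ = (M * √K) * ε * (1 / ((j : ℝ) + 2) ^ 2) * ((2 : ℝ) ^ (p * m + p - p * j) *
          (2 : ℝ) ^ ((j : ℝ) + 1) * (2 : ℝ) ^ (-(p + δ / 2) * (m : ℝ))) := by
          rw [show (j : ℝ) + 1 + 1 = j + 2 by ring]; ring
      _ ≤ (M * √K) * ε * (1 / ((j : ℝ) + 2) ^ 2) * ((2 : ℝ) ^ (1 : ℝ) * 2 ^ p * R) := by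
          rw [hR, ← Real.rpow_add h2, ← Real.rpow_add h2, ← Real.rpow_add h2, ← Real.rpow_add h2]
          refine mul_le_mul_of_nonneg_left
            (Real.rpow_le_rpow_of_exponent_le one_le_two ?_) (by positivity)
          nlinarith [mul_nonneg (by linarith : 0 ≤ p - 1) (Nat.cast_nonneg (α := ℝ) j),
            mul_nonneg hδ.le hm]
      _ = _ := by rw [Real.rpow_one]; ring
  have t3 : (2 : ℝ) ^ (p * m + p - p * (0 : ℕ)) * (M * ε * √(cellBound p δ K m 0)) =
      2 ^ p * (M * √K) * ε * R := by
    rw [sqrt_cellBound hK]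
    have : R * 2 ^ p =
        (2 : ℝ) ^ (p * m + p - p * (0 : ℕ)) * (2 : ℝ) ^ (-(p + δ / 2) * (m : ℝ)) := by
      rw [hR, ← Real.rpow_add h2, ← Real.rpow_add h2]
      congr 1; push_cast; ring
    calc _ = M * √K * ε * ((2 : ℝ) ^ (p * m + p - p * (0 : ℕ)) *
          (2 : ℝ) ^ (-(p + δ / 2) * (m : ℝ))) := by norm_num; ring
      _ = _ := by rw [← this]; ring
  have t4 : ∑ j ∈ Finset.range L, (2 : ℝ) ^ (p * m + p - p * j) * 2 ^ (j + 1) *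
        (M * ε * √(cellBound p δ K m (j + 1))) ≤ 2 * 2 ^ p * (M * √K) * ε * R * 1 := by
    refine (Finset.sum_le_sum fun j _ => t2 j).trans ?_
    rw [← Finset.mul_sum]
    gcongr
    refine (sum_range_inv_sq_le L).trans ?_
    have : 0 ≤ 1 / ((L : ℝ) + 1) := by positivity
    linarith
  rw [t3]
  linarith

/-- Mass alone suffices far out: `2^(pm) 2^(-(2p+δ)m)` contains `2^(-pm)`, which is at most `ε` once
`m ≥ L + 1`. -/
lemma far_term_le {p δ K ε : ℝ} (hp : 1 ≤ p) (hδ : 0 < δ) (hK : 0 < K) {L m : ℕ}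
    (hL : (2 : ℝ) ^ (-(p * (L + 1))) ≤ ε) (hm : L < m) :
    (2 : ℝ) ^ (p * m + p - p * (0 : ℕ)) * (2 * (K * (2 : ℝ) ^ (-(2 * p + δ) * (m : ℝ)))) +
      (2 : ℝ) ^ (p * m + p - p * (0 : ℕ)) * (2 * (K * (2 : ℝ) ^ (-(2 * p + δ) * (m : ℝ)))) ≤
    4 * 2 ^ p * K * ε * (2 : ℝ) ^ (-(δ / 2) * (m : ℝ)) := by
  have h2 : (0 : ℝ) < 2 := by norm_num
  have hm' : (L : ℝ) + 1 ≤ m := by exact_mod_cast hm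
  have hm0 : (0 : ℝ) ≤ m := Nat.cast_nonneg m
  calc _ = 4 * K * ((2 : ℝ) ^ (p * m + p - p * (0 : ℕ)) *
        (2 : ℝ) ^ (-(2 * p + δ) * (m : ℝ))) := by ring
    _ ≤ 4 * K * (2 ^ p * (2 : ℝ) ^ (-(p * (L + 1))) * (2 : ℝ) ^ (-(δ / 2) * (m : ℝ))) := by
        rw [← Real.rpow_add h2, ← Real.rpow_add h2, ← Real.rpow_add h2]
        refine mul_le_mul_of_nonneg_left
          (Real.rpow_le_rpow_of_exponent_le one_le_two ?_) (by positivity)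
        push_cast
        nlinarith [mul_nonneg hδ.le hm0, mul_nonneg (by linarith : 0 ≤ p)
            (by linarith : 0 ≤ (m : ℝ) - (L + 1))]
    _ ≤ 4 * K * (2 ^ p * ε * (2 : ℝ) ^ (-(δ / 2) * (m : ℝ))) := by gcongr
    _ = _ := by ring

theorem wasserstein_rpow_le_of_cells {p δ K M ε : ℝ} (hp : 1 ≤ p) (hδ : 0 < δ) (hK : 0 < K)
    (hM : 0 < M) (hε : 0 < ε) {L : ℕ} (hL : (2 : ℝ) ^ (-(p * L)) ≤ 2 ^ p * ε)
    (hL' : (2 : ℝ) ^ (-(p * (L + 1))) ≤ ε) {P Q : ProbabilityMeasure ℝ}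
    (hP : CellTailBound p δ K P 0) (hQ : CellTailBound p δ K Q 0)
    (hPQ : ∀ m ≤ L, ∀ l ≤ L, ∀ k < 2 ^ l,
      |(P : Measure ℝ).real (cell m l k) - (Q : Measure ℝ).real (cell m l k)| ≤
        M * ε * √(cellBound p δ K m l)) :
    wasserstein p P Q ^ p ≤ ENNReal.ofReal (wassersteinConst p δ K M * ε) := by
  have h2 : (0 : ℝ) < 2 := by norm_num
  set b : ℕ → ℝ := fun m => K * (2 : ℝ) ^ (-(2 * p + δ) * (m : ℝ)) with hb
  have hb0 (m : ℕ) : 0 ≤ b m := by simp only [hb]; positivity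
  have hann (m : ℕ) : (P : Measure ℝ) (annulus m) + (Q : Measure ℝ) (annulus m) ≤
      ENNReal.ofReal (2 * b m) := by
    rw [two_mul, ENNReal.ofReal_add (hb0 m) (hb0 m)]
    exact add_le_add (hP.annulus_le m) (hQ.annulus_le m)
  set T : ℕ → ℕ → ℝ := fun m l => if m ≤ L then M * ε * √(cellBound p δ K m l) else 2 * b m
    with hTdef
  have hT0 (m l : ℕ) : 0 ≤ T m l := by
    simp only [hTdef]
    split_ifs
    · positivity
    · linarith [hb0 m]
  -- Annuli beyond `L` are not subdivided; there the discrepancy is bounded by the total mass.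
  set N : ℕ → ℕ := fun m => if m ≤ L then L else 0 with hN
  have key := wasserstein_rpow_le_tsum hp P Q N (T := fun m l => ENNReal.ofReal (T m l)) (by
    intro m l hl k hk
    by_cases hm : m ≤ L
    · simp only [hN, hTdef, hm, if_true] at hl ⊢
      rw [discrepancy_eq_ofReal]
      exact ENNReal.ofReal_le_ofReal (hPQ m hm l hl k hk)
    · simp only [hN, hTdef, hm, if_false, Nat.le_zero] at hl ⊢
      subst hl
      obtain rfl : k = 0 := by simpa using hk
      rw [cell_zero]
      exact (add_le_add tsub_le_self tsub_le_self).trans (hann m))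
  set C₀ := 2 ^ p * 2 ^ p * (2 * K) + 3 * 2 ^ p * (M * √K) + 4 * 2 ^ p * K with hC₀
  have hC₀pos : 0 < C₀ := by positivity
  set r := (2 : ℝ) ^ (-(δ / 2)) with hr
  have hr0 : 0 < r := by positivity
  have hr1 : r < 1 := Real.rpow_lt_one_of_one_lt_of_neg (by norm_num) (by linarith)
  have hterm (m : ℕ) : (2 : ℝ) ^ (p * m + p - p * N m) * (2 * b m) +
      ∑ j ∈ Finset.range (N m), (2 : ℝ) ^ (p * m + p - p * j) * 2 ^ (j + 1) * T m (j + 1) +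
      (2 : ℝ) ^ (p * m + p - p * (0 : ℕ)) * T m 0 ≤ C₀ * ε * r ^ m := by
    have hrm : r ^ m = (2 : ℝ) ^ (-(δ / 2) * (m : ℝ)) := by
      rw [hr, Real.rpow_mul_natCast h2.le]
    by_cases hm : m ≤ L
    · simp only [hN, hTdef, hm, if_true]
      refine (near_term_le hp hδ hK hM hε hL m).trans ?_
      rw [← hrm, hC₀]
      refine mul_le_mul_of_nonneg_right (mul_le_mul_of_nonneg_right ?_ hε.le) (by positivity)
      linarith [show 0 < 4 * 2 ^ p * K by positivity]
    · simp only [hN, hTdef, hm, if_false, Finset.range_zero, Finset.sum_empty, add_zero]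
      refine (far_term_le hp hδ hK hL' (not_le.1 hm)).trans ?_
      rw [← hrm, hC₀]
      refine mul_le_mul_of_nonneg_right (mul_le_mul_of_nonneg_right ?_ hε.le) (by positivity)
      have : 0 ≤ 2 ^ p * 2 ^ p * (2 * K) + 3 * 2 ^ p * (M * √K) := by positivity
      linarith
  calc _ ≤ _ := key
    _ ≤ ∑' m, ENNReal.ofReal (C₀ * ε * r ^ m) := by
        refine ENNReal.tsum_le_tsum fun m => ?_
        refine le_trans ?_ (ENNReal.ofReal_le_ofReal (hterm m))
        have hnn (j : ℕ) : 0 ≤ (2 : ℝ) ^ (p * m + p - p * j) * 2 ^ (j + 1) * T m (j + 1) :=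
          mul_nonneg (by positivity) (hT0 _ _)
        rw [ENNReal.ofReal_add (add_nonneg (mul_nonneg (by positivity) (by linarith [hb0 m]))
            (Finset.sum_nonneg fun j _ => hnn j)) (mul_nonneg (by positivity) (hT0 _ _)),
          ENNReal.ofReal_add (mul_nonneg (by positivity) (by linarith [hb0 m]))
            (Finset.sum_nonneg fun j _ => hnn j),
          ENNReal.ofReal_sum_of_nonneg fun j _ => hnn j,
          ENNReal.ofReal_mul (q := 2 * b m) (by positivity),
          ENNReal.ofReal_mul (q := T m 0) (by positivity)]
        simp only [cellCost, rpow_diam]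
        gcongr with j
        · exact hann m
        · rw [ENNReal.ofReal_mul (by positivity), ENNReal.ofReal_mul (by positivity),
            ENNReal.ofReal_pow h2.le, ENNReal.ofReal_ofNat]
    _ = _ := by
        rw [← ENNReal.ofReal_tsum_of_nonneg (fun m => by positivity)
          ((summable_geometric_of_lt_one hr0.le hr1).mul_left _), tsum_mul_left,
          tsum_geometric_of_lt_one hr0.le hr1, wassersteinConst]
        congr 1
        rw [← hC₀, ← hr]
        field_simp

/-! ### Posterior contraction -/

/-- The measures whose value at `A` is at most `q` and deviates from that of `P₀` by more
than `t`. -/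
def deviationSet (𝓕 : Set (ProbabilityMeasure ℝ)) (P₀ : ProbabilityMeasure ℝ) (A : Set ℝ)
    (q t : ℝ) : Set 𝓕 :=
  {P | ((P : ProbabilityMeasure ℝ) : Measure ℝ).real A ≤ q ∧
    t < |((P : ProbabilityMeasure ℝ) : Measure ℝ).real A - (P₀ : Measure ℝ).real A|}

lemma numerator_deviationSet_le {P₀ : ProbabilityMeasure ℝ} {ν : Measure ℝ}
    (hdens₀m : Measurable dens₀)
    (hdens₀ : (P₀ : Measure ℝ) = ν.withDensity fun x => (dens₀ x : ℝ≥0∞))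
    (hdensm : Measurable (Function.uncurry dens))
    (hdens : ∀ P : 𝓕,
      ((P : ProbabilityMeasure ℝ) : Measure ℝ) = ν.withDensity fun x => (dens P x : ℝ≥0∞))
    (prior : Measure 𝓕) [IsProbabilityMeasure prior] (n : ℕ) {A : Set ℝ}
    (hA : MeasurableSet A) {q t : ℝ} (ht : 0 < t)
    (hq : (P₀ : Measure ℝ).real A ≤ q) {s : ℝ≥0∞} (hs : s ≠ 0) (hs' : s ≠ ∞) :
    Measure.pi (fun _ : Fin n => (P₀ : Measure ℝ))
        {x | 2 * s ≤ ∫⁻ P in deviationSet 𝓕 P₀ A q t, likelihoodRatio dens dens₀ x P ∂prior} ≤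
      2 * (ENNReal.ofReal (Real.exp (-(n * t ^ 2 / (16 * q)))) * (1 + s⁻¹)) := by
  rcases le_or_gt t q with htq | htq
  · have h (σ : ℝ) (hσ : |σ| = 1) := numerator_one_sided_le hdens₀m hdens₀ hdensm hdens prior n hA
      ht htq hq hσ hs hs'
    have hU : deviationSet 𝓕 P₀ A q t ⊆
        {P : 𝓕 | ((P : ProbabilityMeasure ℝ) : Measure ℝ).real A ≤ q ∧
          t < 1 * (((P : ProbabilityMeasure ℝ) : Measure ℝ).real A - (P₀ : Measure ℝ).real A)} ∪
        {P : 𝓕 | ((P : ProbabilityMeasure ℝ) : Measure ℝ).real A ≤ q ∧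
          t < -1 * (((P : ProbabilityMeasure ℝ) : Measure ℝ).real A -
            (P₀ : Measure ℝ).real A)} := by
      rintro P ⟨h1, h2⟩
      rcases lt_abs.1 h2 with h3 | h3
      · exact Or.inl ⟨h1, by linarith⟩
      · exact Or.inr ⟨h1, by linarith⟩
    rw [two_mul (ENNReal.ofReal _ * _)]
    refine le_trans ((measure_mono fun x hx => ?_).trans (measure_union_le _ _))
      (add_le_add (h 1 (by simp)) (h (-1) (by simp)))
    have hx' := (mem_ofPred_eq ▸ hx : 2 * s ≤ _).trans
      ((lintegral_mono_set hU).trans (lintegral_union_le _ _ _))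
    by_contra hcon
    simp only [mem_union, mem_ofPred_eq, not_or, not_le] at hcon
    rw [two_mul] at hx'
    exact (ENNReal.add_lt_add hcon.1 hcon.2).not_ge hx'
  -- Both masses lie in `[0, q]`, so they cannot differ by more than `t > q`.
  · have hU : deviationSet 𝓕 P₀ A q t = ∅ := by
      refine eq_empty_of_forall_notMem fun P ⟨h1, h2⟩ => ?_
      have h3 : 0 ≤ ((P : ProbabilityMeasure ℝ) : Measure ℝ).real A := measureReal_nonneg
      have h4 : 0 ≤ (P₀ : Measure ℝ).real A := measureReal_nonneg
      have h5 := abs_sub_le_of_nonneg_of_le h3 h1 h4 hq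
      linarith
    simp [hU, hs]

/-- The indices of the cells of level at most `L` in the annuli of index at most `L`. -/
def cellIndices (L : ℕ) : Finset (ℕ × ℕ × ℕ) :=
  (Finset.range (L + 1) ×ˢ Finset.range (L + 1) ×ˢ Finset.range (2 ^ L)).filter
    fun c => c.2.2 < 2 ^ c.2.1

lemma mem_cellIndices {L m l k : ℕ} (hm : m ≤ L) (hl : l ≤ L) (hk : k < 2 ^ l) :
    (m, l, k) ∈ cellIndices L := by
  have : 2 ^ l ≤ 2 ^ L := Nat.pow_le_pow_right (by norm_num) hl
  simp only [cellIndices, Finset.mem_filter, Finset.mem_product, Finset.mem_range]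
  omega

lemma lt_of_mem_cellIndices {L : ℕ} {c : ℕ × ℕ × ℕ} (hc : c ∈ cellIndices L) :
    c.2.2 < 2 ^ c.2.1 :=
  (Finset.mem_filter.1 hc).2

lemma card_cellIndices_le (L : ℕ) : (cellIndices L).card ≤ (2 ^ L) ^ 3 := by
  have h : L + 1 ≤ 2 ^ L := Nat.lt_two_pow_self
  calc (cellIndices L).card ≤ (L + 1) * ((L + 1) * 2 ^ L) := by
        refine (Finset.card_filter_le _ _).trans ?_
        simp [Finset.card_product]
    _ ≤ 2 ^ L * (2 ^ L * 2 ^ L) := by gcongr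
    _ = _ := by ring

/-- The finest level used at accuracy `ε`. -/
def maxLevel (p ε : ℝ) : ℕ := ⌊Real.logb 2 ε⁻¹ / p⌋₊

/-! ### The finest level -/

section MaxLevel

variable {p ε : ℝ}

lemma logb_inv_nonneg (hε : 0 < ε) (hε1 : ε ≤ 1) : 0 ≤ Real.logb 2 ε⁻¹ :=
  Real.logb_nonneg (by norm_num) ((one_le_inv₀ hε).2 hε1)

lemma le_floor_of_le_maxLevel (hp : 1 ≤ p) (hε : 0 < ε) (hε1 : ε ≤ 1) {l : ℕ}
    (hl : l ≤ maxLevel p ε) : (l : ℤ) ≤ ⌊Real.logb 2 ε⁻¹ / p⌋ := by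
  rw [Int.le_floor]
  have h0 : 0 ≤ Real.logb 2 ε⁻¹ / p := div_nonneg (logb_inv_nonneg hε hε1) (by linarith)
  exact_mod_cast (Nat.le_floor_iff h0).1 hl

lemma two_pow_maxLevel_le (hp : 1 ≤ p) (hε : 0 < ε) (hε1 : ε ≤ 1) :
    (2 : ℝ) ^ maxLevel p ε ≤ ε⁻¹ := by
  have h0 := logb_inv_nonneg hε hε1
  have h1 : (maxLevel p ε : ℝ) ≤ Real.logb 2 ε⁻¹ :=
    (Nat.floor_le (div_nonneg h0 (by linarith))).trans (div_le_self h0 hp)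
  rw [← Real.rpow_natCast]
  exact (Real.le_logb_iff_rpow_le (by norm_num) (inv_pos.2 hε)).1 h1

lemma two_rpow_maxLevel_add_one_le (hp : 1 ≤ p) (hε : 0 < ε) :
    (2 : ℝ) ^ (-(p * (maxLevel p ε + 1))) ≤ ε := by
  have h1 : Real.logb 2 ε⁻¹ / p < maxLevel p ε + 1 := Nat.lt_floor_add_one _
  rw [div_lt_iff₀ (by linarith), Real.logb_inv] at h1
  refine (Real.le_logb_iff_rpow_le (by norm_num) hε).1 ?_
  linarith

lemma two_rpow_maxLevel_le (hp : 1 ≤ p) (hε : 0 < ε) :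
    (2 : ℝ) ^ (-(p * maxLevel p ε)) ≤ 2 ^ p * ε := by
  have h : -(p * (maxLevel p ε : ℝ)) = p + -(p * (maxLevel p ε + 1)) := by ring
  rw [h, Real.rpow_add (by norm_num)]
  gcongr
  exact two_rpow_maxLevel_add_one_le hp hε

end MaxLevel

/-- A measure of the tail class which is far from `P₀` deviates from it at some cell. -/
lemma subset_deviationSets {p δ K M ε : ℝ} (hp : 1 ≤ p) (hδ : 0 < δ) (hK : 0 < K) (hM : 0 < M)
    (hε : 0 < ε) (hε1 : ε ≤ 1) {P₀ : ProbabilityMeasure ℝ} (hP₀ : ∀ l, CellTailBound p δ K P₀ l) :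
    {P : 𝓕 | ENNReal.ofReal ((wassersteinConst p δ K M + 1) * ε) ≤
        wasserstein p (P : ProbabilityMeasure ℝ) P₀ ^ p} ⊆
      {P : 𝓕 | (P : ProbabilityMeasure ℝ) ∉ tailClass p δ K ε} ∪
        ⋃ c : cellIndices (maxLevel p ε), deviationSet 𝓕 P₀ (cell c.1.1 c.1.2.1 c.1.2.2)
          (cellBound p δ K c.1.1 c.1.2.1) (M * ε * √(cellBound p δ K c.1.1 c.1.2.1)) := by
  intro P hP
  by_contra hcon
  simp only [mem_union, mem_ofPred_eq, not_or, not_not, mem_iUnion, not_exists] at hcon hP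
  obtain ⟨hT, hU⟩ := hcon
  have hcell (l) (hl : l ≤ maxLevel p ε) : CellTailBound p δ K (P : ProbabilityMeasure ℝ) l :=
    hT l (le_floor_of_le_maxLevel hp hε hε1 hl)
  have hW := wasserstein_rpow_le_of_cells hp hδ hK hM hε (two_rpow_maxLevel_le hp hε)
    (two_rpow_maxLevel_add_one_le hp hε) (hcell 0 (Nat.zero_le _)) (hP₀ 0)
    fun m hm l hl k hk => by
      by_contra hlt
      exact hU ⟨(m, l, k), mem_cellIndices hm hl hk⟩ ⟨(hcell l hl).cell_le m hk, not_le.1 hlt⟩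
  -- The added `1` in the constant turns the upper bound into a strict contradiction.
  have hlt : wassersteinConst p δ K M * ε < (wassersteinConst p δ K M + 1) * ε := by linarith
  have hpos := wassersteinConst_pos (p := p) hδ hK hM
  exact ((ENNReal.ofReal_lt_ofReal_iff (by positivity)).2 hlt).not_ge (hP.trans hW)

/-- The samples at which the evidence is small or the prior gives too much weighted mass to
the measures that deviate from `P₀` at some cell. -/
def exceptionalSet (prior : Measure 𝓕) (dens : 𝓕 → ℝ → ℝ≥0) (dens₀ : ℝ → ℝ≥0)
    (P₀ : ProbabilityMeasure ℝ) (p δ K ε : ℝ) (n : ℕ) : Set (Fin n → ℝ) :=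
  {x | ∫⁻ P, likelihoodRatio dens dens₀ x P ∂prior <
      ENNReal.ofReal (Real.exp (-(3 * (n * ε ^ 2))) / 2)} ∪
    ⋃ c ∈ cellIndices (maxLevel p ε),
      {x | 2 * ENNReal.ofReal (Real.exp (-(6 * (n * ε ^ 2)))) ≤
        ∫⁻ P in deviationSet 𝓕 P₀ (cell c.1 c.2.1 c.2.2)
          (cellBound p δ K c.1 c.2.1) (12 * ε * √(cellBound p δ K c.1 c.2.1)),
          likelihoodRatio dens dens₀ x P ∂prior}

/-- Since `n ε² ≥ log n ≥ 1`, one has `ε⁻² ≤ n`, so the `ε⁻³` cells at most number `n² = exp (2 log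
n)`. -/
lemma card_cellIndices_maxLevel_le {p ε : ℝ} (hp : 1 ≤ p) (hε : 0 < ε) (hε1 : ε ≤ 1) {n : ℕ}
    (hn : 1 ≤ Real.log n) (hlog : Real.log n ≤ n * ε ^ 2) :
    ((cellIndices (maxLevel p ε)).card : ℝ) ≤ Real.exp (2 * (n * ε ^ 2)) := by
  have hn0 : (0 : ℝ) < n := by
    rcases Nat.eq_zero_or_pos n with h | h
    · rw [h] at hn; norm_num at hn
    · exact_mod_cast h
  have hinv : 1 ≤ ε⁻¹ := (one_le_inv₀ hε).2 hε1
  have h2 : ε⁻¹ ^ 2 ≤ n := by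
    rw [inv_pow, inv_le_iff_one_le_mul₀ (by positivity)]
    linarith
  calc ((cellIndices (maxLevel p ε)).card : ℝ) ≤ ((2 : ℝ) ^ maxLevel p ε) ^ 3 := by
        exact_mod_cast card_cellIndices_le _
    _ ≤ ε⁻¹ ^ 3 := by gcongr; exact two_pow_maxLevel_le hp hε hε1
    _ ≤ ε⁻¹ ^ 4 := pow_le_pow_right₀ hinv (by norm_num)
    _ = (ε⁻¹ ^ 2) ^ 2 := by ring
    _ ≤ (n : ℝ) ^ 2 := by gcongr
    _ = Real.exp (2 * Real.log n) := by
        rw [two_mul, Real.exp_add, Real.exp_log hn0, sq]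
    _ ≤ _ := by gcongr

/-- Union bound with `y = n ε²`: `exp (2y)` cells, Chernoff factor `exp (-9y)` and Markov loss `exp
(6y)` leave `exp (-y)`. -/
lemma exceptionalSet_le {P₀ : ProbabilityMeasure ℝ} {ν : Measure ℝ}
    (hdens₀m : Measurable dens₀)
    (hdens₀ : (P₀ : Measure ℝ) = ν.withDensity fun x => (dens₀ x : ℝ≥0∞))
    (hdensm : Measurable (Function.uncurry dens))
    (hdens : ∀ P : 𝓕,
      ((P : ProbabilityMeasure ℝ) : Measure ℝ) = ν.withDensity fun x => (dens P x : ℝ≥0∞))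
    (prior : Measure 𝓕) [IsProbabilityMeasure prior] {p δ K ε : ℝ} (hp : 1 ≤ p) (hK : 0 < K)
    (hε : 0 < ε) (hε1 : ε ≤ 1) {n : ℕ} (hn : 1 ≤ Real.log n) (hlog : Real.log n ≤ n * ε ^ 2)
    (hKL : Real.exp (-(n * ε ^ 2)) ≤ prior.real (klNeighborhood dens P₀ dens₀ ε))
    (hP₀ : ∀ l, CellTailBound p δ K P₀ l) :
    Measure.pi (fun _ : Fin n => (P₀ : Measure ℝ))
        (exceptionalSet prior dens dens₀ P₀ p δ K ε n) ≤
      ENNReal.ofReal (2 / (n * ε ^ 2) + 4 * Real.exp (-(n * ε ^ 2))) := by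
  have hn0 : 0 < n := by
    rcases Nat.eq_zero_or_pos n with h | h
    · rw [h] at hn; norm_num at hn
    · exact h
  have hn0' : (0 : ℝ) < n := by exact_mod_cast hn0
  have hcard := card_cellIndices_maxLevel_le hp hε hε1 hn hlog
  set y : ℝ := n * ε ^ 2 with hy
  have hy0 : 0 < y := by positivity
  rw [ENNReal.ofReal_add (by positivity) (by positivity)]
  refine (measure_union_le _ _).trans (add_le_add
    (evidence_lt_le hdens₀m hdens₀ hdensm prior hn0 hε hKL) ?_)
  set s := ENNReal.ofReal (Real.exp (-(6 * y))) with hs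
  have hs0 : s ≠ 0 := by simp [hs, Real.exp_pos]
  have hsinv : 1 + s⁻¹ = ENNReal.ofReal (1 + Real.exp (6 * y)) := by
    rw [hs, ← ENNReal.ofReal_inv_of_pos (Real.exp_pos _), ← Real.exp_neg, neg_neg,
      ENNReal.ofReal_add zero_le_one (Real.exp_nonneg _), ENNReal.ofReal_one]
  refine (measure_biUnion_finset_le _ _).trans ?_
  calc _ ≤ ∑ c ∈ cellIndices (maxLevel p ε),
        ENNReal.ofReal (2 * (Real.exp (-(9 * y)) * (1 + Real.exp (6 * y)))) := by
        refine Finset.sum_le_sum fun c hc => ?_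
        have hq := cellBound_pos (p := p) (δ := δ) hK c.1 c.2.1
        refine (numerator_deviationSet_le hdens₀m hdens₀ hdensm hdens prior n
          (measurableSet_cell c.1 c.2.1 c.2.2) (by positivity)
          ((hP₀ c.2.1).cell_le c.1 (lt_of_mem_cellIndices hc)) hs0
          ENNReal.ofReal_ne_top).trans (le_of_eq ?_)
        rw [hsinv, ← ENNReal.ofReal_mul (Real.exp_nonneg _),
          ENNReal.ofReal_mul (p := 2) (by norm_num), ENNReal.ofReal_ofNat]
        -- The threshold proportional to `√q` cancels `q` and makes the exponent the same for all
        -- cells: `12² / 16 = 9`.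
        have : n * (12 * ε * √(cellBound p δ K c.1 c.2.1)) ^ 2 /
            (16 * cellBound p δ K c.1 c.2.1) = 9 * y := by
          rw [mul_pow, Real.sq_sqrt hq.le, hy]
          field_simp
          ring
        rw [this]
    _ = ENNReal.ofReal ((cellIndices (maxLevel p ε)).card *
          (2 * (Real.exp (-(9 * y)) * (1 + Real.exp (6 * y))))) := by
        rw [Finset.sum_const, nsmul_eq_mul, ENNReal.ofReal_mul (Nat.cast_nonneg _),
          ENNReal.ofReal_natCast]
    _ ≤ ENNReal.ofReal (Real.exp (2 * y) *
          (2 * (Real.exp (-(9 * y)) * (Real.exp (6 * y) + Real.exp (6 * y))))) := by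
        gcongr
        exact Real.one_le_exp (by positivity)
    _ = ENNReal.ofReal (4 * Real.exp (-y)) := by
        congr 1
        have : Real.exp (-y) = Real.exp (2 * y) * Real.exp (-(9 * y)) * Real.exp (6 * y) := by
          rw [← Real.exp_add, ← Real.exp_add]; congr 1; ring
        rw [this]; ring

lemma abs_posterior (prior : Measure 𝓕) {n : ℕ} (x : Fin n → ℝ) (A : Set 𝓕) :
    |posterior prior dens dens₀ x A| = posterior prior dens dens₀ x A :=
  abs_of_nonneg ENNReal.toReal_nonneg

/-- Off the exceptional set the deviating measures contribute at most `exp (2y) · 2 exp (-6y)` to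
the numerator, against evidence at least `exp (-3y) / 2`. Only monotonicity and subadditivity in the
domain are used, so measurability of the Wasserstein event is not needed. -/
lemma posterior_le_add {P₀ : ProbabilityMeasure ℝ} (prior : Measure 𝓕) {p δ K ε : ℝ}
    (hp : 1 ≤ p) (hδ : 0 < δ) (hK : 0 < K) (hε : 0 < ε) (hε1 : ε ≤ 1) {n : ℕ}
    (hn : 1 ≤ Real.log n) (hlog : Real.log n ≤ n * ε ^ 2)
    (hP₀ : ∀ l, CellTailBound p δ K P₀ l) {x : Fin n → ℝ}
    (hx : x ∉ exceptionalSet prior dens dens₀ P₀ p δ K ε n) :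
    posterior prior dens dens₀ x {P : 𝓕 |
        ENNReal.ofReal ((wassersteinConst p δ K 12 + 1) * ε) ≤
          wasserstein p (P : ProbabilityMeasure ℝ) P₀ ^ p} ≤
      posterior prior dens dens₀ x {P : 𝓕 | (P : ProbabilityMeasure ℝ) ∉ tailClass p δ K ε} +
        4 * Real.exp (-(n * ε ^ 2)) := by
  have hcard := card_cellIndices_maxLevel_le hp hε hε1 hn hlog
  simp only [exceptionalSet, mem_union, mem_iUnion, not_or, not_exists, mem_ofPred_eq, not_lt,
    not_le] at hx
  obtain ⟨hden, hnum⟩ := hx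
  set y : ℝ := n * ε ^ 2 with hy
  set W := {P : 𝓕 | ENNReal.ofReal ((wassersteinConst p δ K 12 + 1) * ε) ≤
    wasserstein p (P : ProbabilityMeasure ℝ) P₀ ^ p}
  set T := {P : 𝓕 | (P : ProbabilityMeasure ℝ) ∉ tailClass p δ K ε}
  set d := ∫⁻ P, likelihoodRatio dens dens₀ x P ∂prior with hd
  change ((∫⁻ P in W, likelihoodRatio dens dens₀ x P ∂prior) / d).toReal ≤
    ((∫⁻ P in T, likelihoodRatio dens dens₀ x P ∂prior) / d).toReal + _
  -- The quotient is at most `1` even if the evidence is `0` or `∞`, by the conventions of division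
  -- in `ℝ≥0∞`.
  have hfin : (∫⁻ P in T, likelihoodRatio dens dens₀ x P ∂prior) / d ≠ ∞ :=
    ne_top_of_le_ne_top ENNReal.one_ne_top
      ((ENNReal.div_le_div_right (setLIntegral_le_lintegral _ _) _).trans ENNReal.div_self_le_one)
  have hW : ∫⁻ P in W, likelihoodRatio dens dens₀ x P ∂prior ≤
      ∫⁻ P in T, likelihoodRatio dens dens₀ x P ∂prior +
        ENNReal.ofReal (2 * Real.exp (-(4 * y))) := by
    refine (lintegral_mono_set (subset_deviationSets hp hδ hK (by norm_num) hε hε1 hP₀)).trans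
      ((lintegral_union_le _ _ _).trans (add_le_add le_rfl ?_))
    refine (lintegral_iUnion_le _ _).trans ?_
    rw [tsum_fintype]
    calc _ ≤ ∑ _c : cellIndices (maxLevel p ε), ENNReal.ofReal (2 * Real.exp (-(6 * y))) := by
          refine Finset.sum_le_sum fun c _ => ?_
          rw [ENNReal.ofReal_mul (by norm_num), ENNReal.ofReal_ofNat]
          exact (hnum c.1 c.2).le
      _ = ENNReal.ofReal ((cellIndices (maxLevel p ε)).card * (2 * Real.exp (-(6 * y)))) := by
          rw [Finset.sum_const, nsmul_eq_mul, ENNReal.ofReal_mul (Nat.cast_nonneg _),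
            ENNReal.ofReal_natCast, Finset.card_univ, Fintype.card_coe]
      _ ≤ ENNReal.ofReal (Real.exp (2 * y) * (2 * Real.exp (-(6 * y)))) := by gcongr
      _ = _ := by
          congr 1
          rw [mul_left_comm, ← Real.exp_add]
          congr 2; ring
  have hle : (∫⁻ P in W, likelihoodRatio dens dens₀ x P ∂prior) / d ≤
      (∫⁻ P in T, likelihoodRatio dens dens₀ x P ∂prior) / d +
        ENNReal.ofReal (4 * Real.exp (-y)) := by
    refine (ENNReal.div_le_div_right hW d).trans ?_
    rw [ENNReal.add_div]
    gcongr
    calc _ ≤ ENNReal.ofReal (2 * Real.exp (-(4 * y))) /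
          ENNReal.ofReal (Real.exp (-(3 * y)) / 2) := by gcongr
      _ = _ := by
          rw [← ENNReal.ofReal_div_of_pos (by positivity)]
          congr 1
          rw [show -(4 * y) = -y + -(3 * y) by ring, Real.exp_add]
          field_simp
          norm_num
  refine (ENNReal.toReal_mono (ENNReal.add_ne_top.2 ⟨hfin, ENNReal.ofReal_ne_top⟩) hle).trans ?_
  rw [ENNReal.toReal_add hfin ENNReal.ofReal_ne_top, ENNReal.toReal_ofReal (by positivity)]

/-- An inequality is enough, and it holds for arbitrary `S`, so the exceptional set need not be
shown measurable. -/
lemma measure_sample_mem_le {Ω : Type*} [MeasurableSpace Ω] {μ : Measure Ω}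
    [IsProbabilityMeasure μ] {P₀ : ProbabilityMeasure ℝ} {X : ℕ → Ω → ℝ}
    (hXlaw : ∀ i, HasLaw (X i) (P₀ : Measure ℝ) μ) (hXindep : iIndepFun X μ) (n : ℕ)
    (S : Set (Fin n → ℝ)) :
    μ {ω | (fun i : Fin n => X i ω) ∈ S} ≤
      Measure.pi (fun _ : Fin n => (P₀ : Measure ℝ)) S := by
  have hm (i : Fin n) : AEMeasurable (X i) μ := (hXlaw i).aemeasurable
  have h := (iIndepFun_iff_map_fun_eq_pi_map hm).1
    (hXindep.precomp (g := fun i : Fin n => (i : ℕ)) Fin.val_injective)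
  have h' : Measure.pi (fun _ : Fin n => (P₀ : Measure ℝ)) =
      μ.map fun ω (i : Fin n) => X i ω := by
    rw [h]
    congr 1
    ext1 i
    exact (hXlaw i).map_eq.symm
  rw [h']
  exact Measure.le_map_apply (aemeasurable_pi_lambda _ hm) S

end WassersteinPosterior

end

theorem mainTheorem9
    -- the data: i.i.d. observations with law `P₀`
    {Ω : Type*} [MeasurableSpace Ω] (μ : Measure Ω) [IsProbabilityMeasure μ]
    (P₀ : ProbabilityMeasure ℝ) (X : ℕ → Ω → ℝ)
    (hXlaw : ∀ i, HasLaw (X i) (P₀ : Measure ℝ) μ) (hXindep : iIndepFun X μ)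
    -- densities with respect to a reference measure; `dens P x` is the density of `P` at `x`
    (ν : Measure ℝ) [SigmaFinite ν]
    (dens₀ : ℝ → ℝ≥0) (hdens₀m : Measurable dens₀)
    (hdens₀ : (P₀ : Measure ℝ) = ν.withDensity fun x => (dens₀ x : ℝ≥0∞))
    (𝓕 : Set (ProbabilityMeasure ℝ)) (dens : 𝓕 → ℝ → ℝ≥0)
    (hdensm : Measurable (Function.uncurry dens))
    (hdens : ∀ P : 𝓕,
      ((P : ProbabilityMeasure ℝ) : Measure ℝ) = ν.withDensity fun x => (dens P x : ℝ≥0∞))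
    -- the prior, which may depend on the sample size; the σ-algebra on `𝓕` is the trace of the
    -- Borel σ-algebra of the weak topology
    (prior : ℕ → Measure 𝓕) [∀ n, IsProbabilityMeasure (prior n)]
    (p : ℝ) (hp : 1 ≤ p)
    -- the rate and the KL condition
    (ε : ℕ → ℝ) (hε : Tendsto ε atTop (𝓝 0))
    (hεlog : ∀ n : ℕ, 1 ≤ n → Real.sqrt (Real.log n / n) ≤ ε n)
    (hKL : ∀ᶠ n : ℕ in atTop, Real.exp (-(n * ε n ^ 2)) ≤
      (prior n).real (WassersteinPosterior.klNeighborhood dens P₀ dens₀ (ε n)))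
    -- the tail conditions on `P₀` and on the posterior
    (K δ : ℝ) (hK : 0 < K) (hδ : 0 < δ)
    (hP₀ : ∀ l : ℕ, WassersteinPosterior.CellTailBound p δ K P₀ l)
    (hpost : TendstoInMeasure μ
      (fun (n : ℕ) ω => WassersteinPosterior.posterior (prior n) dens dens₀
        (fun i : Fin n => X i ω)
        {P : 𝓕 | (P : ProbabilityMeasure ℝ) ∉ WassersteinPosterior.tailClass p δ K (ε n)})
      atTop (fun _ => 0)) :
    ∃ K' : ℝ, 0 < K' ∧
      TendstoInMeasure μ
        (fun (n : ℕ) ω => WassersteinPosterior.posterior (prior n) dens dens₀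
          (fun i : Fin n => X i ω)
          {P : 𝓕 | ENNReal.ofReal (K' * ε n) ≤
            WassersteinPosterior.wasserstein p (P : ProbabilityMeasure ℝ) P₀ ^ p})
        atTop (fun _ => 0) := by
  have hpos := WassersteinPosterior.wassersteinConst_pos (p := p) (M := 12) hδ hK (by norm_num)
  -- `12` is the deviation multiplier used in `exceptionalSet`.
  refine ⟨WassersteinPosterior.wassersteinConst p δ K 12 + 1, by linarith, ?_⟩
  have hlogn : Tendsto (fun n : ℕ => Real.log n) atTop atTop :=
    Real.tendsto_log_atTop.comp tendsto_natCast_atTop_atTop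
  have hprop : ∀ᶠ n : ℕ in atTop, 0 < ε n ∧ ε n ≤ 1 ∧ 1 ≤ Real.log n ∧
      Real.log n ≤ n * ε n ^ 2 := by
    filter_upwards [hε.eventually (Iic_mem_nhds zero_lt_one), hlogn.eventually_ge_atTop 1,
      eventually_ge_atTop 1] with n h1 h2 h3
    have hn : (0 : ℝ) < n := by exact_mod_cast h3
    have h4 : 0 < Real.log n / n := by positivity
    have h5 := hεlog n h3
    have h6 : 0 < ε n := (Real.sqrt_pos.2 h4).trans_le h5
    refine ⟨h6, h1, h2, ?_⟩
    have h7 := (Real.sqrt_le_left h6.le).1 h5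
    rwa [div_le_iff₀' hn] at h7
  have hY : Tendsto (fun n : ℕ => (n : ℝ) * ε n ^ 2) atTop atTop :=
    tendsto_atTop_mono' _ (hprop.mono fun n h => h.2.2.2) hlogn
  have hexp : Tendsto (fun n : ℕ => 4 * Real.exp (-(n * ε n ^ 2))) atTop (𝓝 0) := by
    simpa using (Real.tendsto_exp_neg_atTop_nhds_zero.comp hY).const_mul 4
  have hrate : Tendsto (fun n : ℕ => ENNReal.ofReal
      (2 / (n * ε n ^ 2) + 4 * Real.exp (-(n * ε n ^ 2)))) atTop (𝓝 0) := by
    have := ENNReal.tendsto_ofReal ((tendsto_const_nhds (x := (2 : ℝ)).div_atTop hY).add hexp)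
    simpa using this
  rw [tendstoInMeasure_iff_dist] at hpost ⊢
  intro η hη
  refine tendsto_of_tendsto_of_tendsto_of_le_of_le' tendsto_const_nhds
    (by simpa using (hpost (η / 2) (by linarith)).add hrate) (Eventually.of_forall fun _ => zero_le)
    ?_
  filter_upwards [hprop, hKL, hexp.eventually (Iio_mem_nhds (half_pos hη))]
    with n ⟨hε0, hε1, hn, hlog⟩ hKLn hexpn
  -- Once `4 exp (-n ε²) < η / 2`, posterior mass at least `η` forces either mass at least `η / 2`
  -- outside the tail class or an exceptional sample; both probabilities tend to zero.
  refine le_trans (measure_mono fun ω hω => ?_) ((measure_union_le _ _).trans (add_le_add le_rfl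
    ((WassersteinPosterior.measure_sample_mem_le hXlaw hXindep n _).trans
      (WassersteinPosterior.exceptionalSet_le hdens₀m hdens₀ hdensm hdens (prior n) hp hK hε0 hε1
        hn hlog hKLn hP₀))))
  by_contra hcon
  simp only [mem_union, mem_ofPred_eq, not_or, not_le, Real.dist_eq, sub_zero,
    WassersteinPosterior.abs_posterior] at hcon hω
  obtain ⟨h1, h2⟩ := hcon
  have h3 := WassersteinPosterior.posterior_le_add (prior n) hp hδ hK hε0 hε1 hn hlog hP₀ h2
  have h4 : 4 * Real.exp (-(n * ε n ^ 2)) < η / 2 := hexpn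
  linarith
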